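/- Work on $\mathbb R$ with Lebesgue measure; functions take values in $\mathbb K=\mathbb R$ or $\mathbb C$. For $\alpha\in\{0,\frac13\}$ let $\mathbb D^\alpha=\{2^{-k}([0,1]+m+(-1)^k\alpha):k,m\in\mathbb Z\}$ and $\mathbb D=\mathbb D^0\cup\mathbb D^{1/3}$. A collection $\mathcal S\subset\mathbb D$ is $\eta$-sparse if there are pairwise disjoint measurable sets $E_Q\subset Q$ $(Q\in\mathcal S)$ with $|E_Q|\ge\eta|Q|$. For an interval $I$ put $\chi_I(x)=(1+d(x,I)/|I|)^{-1}$. For a finite collection $\mathscr I\subset\mathbb D^0$ and $I_0\in\mathbb D^0$ put $\mathscr I(I_0)=\{I\in\mathscr I:I\subset I_0\}$, $\mathscr I^+(I_0)=\mathscr I(I_0)\cup\{I_0\}$. Given maps $a_I:L^2(\mathbb R)\to\mathbb K$ $(I\in\mathbb D^0)$ and an integer $M$, put, for $f \in L^2$, $$\mathrm{size}_{\mathscr I,I_0}f=\sup_{I\in\mathscr I^+(I_0)}\Big(\frac1{|I|}\sum_{J\in\mathscr I(I)}|a_J(f)|^2\Big)^{1/2},\qquad \widetilde{\mathrm{size}}_{\mathscr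 I,I_0}f=\sup_{J\in\mathscr I^+(I_0)}\frac1{|J|}\int_{\mathbb R}|f|\chi_J^M\,dx .$$ **Theorem.** There is an absolute $\eta\in(0,1)$ such that for every integer $M\ge3$ and all $C_0,C_1,C_2\ge0$ there are a finite constant $C$ and, for each $p\in(1,\infty)$, a finite constant $K_p$, depending only on $M,C_0,C_1,C_2$ (and $p$), with the following property. Let $T$ be a bounded linear operator on $L^2(\mathbb R)$ and $a_I:L^2(\mathbb R)\to\mathbb K$, $I\in\mathbb D^0$, coefficients such that for all $f,g\in L^2$, all $I_0\in\mathbb D^0$ and all finite $\mathscr I\subset\mathbb D^0$: * $|\langle Tf,g\rangle|\le C_0\sum_{I\in\mathbb D^0}|a_I(f)||a_I(g)|$; * (energy) $\sum_{I\in\mathbb D^0,\,I\subset I_0}|a_I(f)|^2\le C_1\|f\chi_{I_0}^M\|_2^2$; * (Carleson condition on the size) $\mathrm{size}_{\mathscr I,I_0}f\le C_2\,\widetilde{\mathrm{size}}_{\mathscr I,I_0}f$. Then: 1. For all finite $\mathscr I\subset\mathbb D^0$, all $(\epsilon_I)\subset\mathbb K$ with $|\epsilon_I|\le1$, all $I_0\in\mathbb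 D^0$ and $f,g\in L^2$, $$\Big|\sum_{I\in\mathscr I(I_0)}\epsilon_Ia_I(f)a_I(g)\Big|\le C\,\widetilde{\mathrm{size}}_{\mathscr I,I_0}f\cdot\widetilde{\mathrm{size}}_{\mathscr I,I_0}g\cdot|I_0|.$$ 2. For all such $\mathscr I,(\epsilon_I),f,g$ there is an $\eta$-sparse $\mathcal S\subset\mathbb D^0$ with $$\Big|\sum_{I\in\mathscr I}\epsilon_Ia_I(f)a_I(g)\Big|\le C\sum_{Q\in\mathcal S}\Big(\frac1{|Q|}\int_{\mathbb R}|f|\chi_Q^M\,dx\Big)\Big(\frac1{|Q|}\int_{\mathbb R}|g|\chi_Q^M\,dx\Big)|Q|.$$ 3. For all $f,g\in L^2$ there is an $\eta$-sparse $\mathcal S\subset\mathbb D$ with $$|\langle Tf,g\rangle|\le C\sum_{Q\in\mathcal S}\Big(\frac1{|Q|}\int_Q|f|\,dx\Big)\Big(\frac1{|Q|}\int_Q|g|\,dx\Big)|Q|.$$ 4. $T$ and its adjoint $T^*$ are of weak type $(1,1)$: for $S\in\{T,T^*\}$, $f\in L^1\cap L^2$ and $t>0$, $\;t\,|\{x:|Sf(x)|>t\}|\le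 C\|f\|_1$. 5. For every $p\in(1,\infty)$ and every weight $\omega\in A_p$, $$\|T\|_{L^p(\omega)\to L^p(\omega)}+\|T^*\|_{L^p(\omega)\to L^p(\omega)}\le K_p\,[\omega]_{A_p}^{\max\{1,1/(p-1)\}},$$ where the norms are computed on $L^2\cap L^p(\omega)$ and $[\omega]_{A_p}=\sup_I\big(\frac1{|I|}\int_I\omega\big)\big(\frac1{|I|}\int_I\omega^{-1/(p-1)}\big)^{p-1}$ over bounded intervals $I$. -/

import Mathlib

open MeasureTheory Set
open scoped ENNReal NNReal

namespace SparseDom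

/-- The dyadic interval `2^{-k} ([0,1] + m + (-1)^k α)` with index `i = (k, m)`. -/
noncomputable def dyadic (α : ℝ) (i : ℤ × ℤ) : Set ℝ :=
  Icc ((2 : ℝ) ^ (-i.1) * (i.2 + (-1) ^ i.1 * α)) ((2 : ℝ) ^ (-i.1) * (1 + i.2 + (-1) ^ i.1 * α))

/-- The dyadic grid with parameter `α`. -/
def grid (α : ℝ) : Set (Set ℝ) := range (dyadic α)

/-- The union of the two dyadic grids, for `α = 0` and `α = 1/3`. -/
def grids : Set (Set ℝ) := grid 0 ∪ grid (1 / 3)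

/-- The standard dyadic interval `2^{-k} [m, m+1]` with index `i = (k, m)`; two different indices
give two different intervals. -/
noncomputable def interval (i : ℤ × ℤ) : Set ℝ := dyadic 0 i

/-- A collection of intervals is `η`-sparse if there are pairwise disjoint measurable
`E Q ⊆ Q`, `Q ∈ S`, with `|E Q| ≥ η |Q|`. -/
def IsSparse (η : ℝ) (S : Set (Set ℝ)) : Prop :=
  ∃ E : Set ℝ → Set ℝ,
    (∀ Q ∈ S, MeasurableSet (E Q) ∧ E Q ⊆ Q ∧ ENNReal.ofReal η * volume Q ≤ volume (E Q)) ∧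
    S.PairwiseDisjoint E

/-- The localizing function `χ_I(x) = (1 + d(x,I) / ℓ(I))⁻¹` of an interval `I`. -/
noncomputable def chi (I : Set ℝ) (x : ℝ) : ℝ :=
  (1 + Metric.infDist x I / volume.real I)⁻¹

/-- The space `L²(ℝ)` with values in `𝕜 = ℝ` or `ℂ`. -/
noncomputable abbrev L2 (𝕜 : Type*) [RCLike 𝕜] := Lp 𝕜 2 (volume : Measure ℝ)

/-- The average `|Q|⁻¹ ∫_Q h`. -/
noncomputable def avg (Q : Set ℝ) (h : ℝ → ℝ≥0∞) : ℝ≥0∞ :=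
  (volume Q)⁻¹ * ∫⁻ x in Q, h x

section

variable {𝕜 : Type*} [RCLike 𝕜]

/-- `‖f χ_I^M‖_q`. -/
noncomputable def locNorm (q : ℝ≥0∞) (M : ℕ) (I : Set ℝ) (f : ℝ → 𝕜) : ℝ≥0∞ :=
  eLpNorm (fun x => ‖f x‖ * chi I x ^ M) q volume

/-- `|I|⁻¹ ‖f χ_I^M‖_1`. -/
noncomputable def locAvg (M : ℕ) (I : Set ℝ) (f : ℝ → 𝕜) : ℝ≥0∞ :=
  (volume I)⁻¹ * locNorm 1 M I f

open Classical in
/-- The members of a finite collection of dyadic intervals that are contained in `I₀`. -/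
noncomputable def below (F : Finset (ℤ × ℤ)) (i₀ : ℤ × ℤ) : Finset (ℤ × ℤ) :=
  F.filter fun i => interval i ⊆ interval i₀

/-- The members of a finite collection of dyadic intervals that are contained in `I₀`,
together with `I₀` itself. -/
noncomputable def belowPlus (F : Finset (ℤ × ℤ)) (i₀ : ℤ × ℤ) : Finset (ℤ × ℤ) :=
  insert i₀ (below F i₀)

/-- The maximal size over `I₀` of the coefficients `a`, for a finite collection `F`:
the supremum over `I ∈ F⁺(I₀)` of `(|I|⁻¹ ∑_{J ∈ F, J ⊆ I} |a_J(f)|²)^{1/2}`. -/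
noncomputable def size (a : ℤ × ℤ → L2 𝕜 → 𝕜) (F : Finset (ℤ × ℤ)) (i₀ : ℤ × ℤ) (f : L2 𝕜) :
    ℝ≥0∞ :=
  ⨆ i ∈ belowPlus F i₀,
    ((volume (interval i))⁻¹ * ∑ j ∈ below F i, ‖a j f‖ₑ ^ 2) ^ (1 / 2 : ℝ)

/-- The `L¹` size over `I₀` for a finite collection `F`:
the supremum over `J ∈ F⁺(I₀)` of `|J|⁻¹ ∫ |f| χ_J^M`. -/
noncomputable def sizeTilde (M : ℕ) (F : Finset (ℤ × ℤ)) (i₀ : ℤ × ℤ) (f : L2 𝕜) : ℝ≥0∞ :=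
  ⨆ j ∈ belowPlus F i₀, locAvg M (interval j) f

/-- `|⟨T f, g⟩| ≤ C ∑_I |a_I(f)| |a_I(g)|` for all `f, g ∈ L²`. -/
def FormBound (T : L2 𝕜 →L[𝕜] L2 𝕜) (a : ℤ × ℤ → L2 𝕜 → 𝕜) (C : ℝ≥0) : Prop :=
  ∀ f g : L2 𝕜, ‖inner 𝕜 (T f) g‖ₑ ≤ C * ∑' i, ‖a i f‖ₑ * ‖a i g‖ₑ

/-- The energy condition `∑_{I ⊆ I₀} |a_I(f)|² ≤ C ‖f χ_{I₀}^M‖_2²`. -/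
def EnergyCondition (a : ℤ × ℤ → L2 𝕜 → 𝕜) (M : ℕ) (C : ℝ≥0) : Prop :=
  ∀ (f : L2 𝕜) (i₀ : ℤ × ℤ),
    ∑' i : {i // interval i ⊆ interval i₀}, ‖a i f‖ₑ ^ 2 ≤ C * locNorm 2 M (interval i₀) f ^ 2

/-- The Carleson condition on the size, uniformly in the finite collection `F`. -/
def SizeCondition (a : ℤ × ℤ → L2 𝕜 → 𝕜) (M : ℕ) (C : ℝ≥0) : Prop :=
  ∀ (f : L2 𝕜) (F : Finset (ℤ × ℤ)) (i₀ : ℤ × ℤ), size a F i₀ f ≤ C * sizeTilde M F i₀ f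

/-- The model form `∑_{I ∈ F} ε_I a_I(f) a_I(g)`. -/
noncomputable def modelForm (a : ℤ × ℤ → L2 𝕜 → 𝕜) (ε : ℤ × ℤ → 𝕜) (F : Finset (ℤ × ℤ))
    (f g : L2 𝕜) : 𝕜 :=
  ∑ i ∈ F, ε i * a i f * a i g

/-- The sparse form `∑_{Q ∈ S} ⟨|f|⟩_Q ⟨|g|⟩_Q |Q|` with `L¹` averages. -/
noncomputable def sparseForm (S : Set (Set ℝ)) (f g : ℝ → 𝕜) : ℝ≥0∞ :=
  ∑' Q : S, avg (Q : Set ℝ) (fun x => ‖f x‖ₑ) * avg (Q : Set ℝ) (fun x => ‖g x‖ₑ) * volume (Q : Set ℝ)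

/-- The sparse form with the averages `|Q|⁻¹ ∫ |f| χ_Q^M`. -/
noncomputable def sparseFormChi (M : ℕ) (S : Set (Set ℝ)) (f g : ℝ → 𝕜) : ℝ≥0∞ :=
  ∑' Q : S, locAvg M (Q : Set ℝ) f * locAvg M (Q : Set ℝ) g * volume (Q : Set ℝ)

/-- Weak type `(1,1)` with constant `C`, on `L¹ ∩ L²`. -/
def WeakTypeOne (T : L2 𝕜 →L[𝕜] L2 𝕜) (C : ℝ≥0) : Prop :=
  ∀ f : L2 𝕜, Integrable f volume → ∀ t : ℝ≥0, 0 < t →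
    t * volume {x | (t : ℝ) < ‖T f x‖} ≤ C * eLpNorm f 1 volume

/-- The norm of an operator on `L^p(ω)`, computed on `L² ∩ L^p(ω)`. -/
noncomputable def weightedOpNorm (T : L2 𝕜 →L[𝕜] L2 𝕜) (p : ℝ) (ω : ℝ → ℝ≥0∞) : ℝ≥0∞ :=
  sInf {K | ∀ f : L2 𝕜, eLpNorm f (ENNReal.ofReal p) (volume.withDensity ω) < ∞ →
    eLpNorm (T f) (ENNReal.ofReal p) (volume.withDensity ω) ≤
      K * eLpNorm f (ENNReal.ofReal p) (volume.withDensity ω)}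

end

/-- The Muckenhoupt characteristic `[ω]_{A_p}`: the supremum over all bounded intervals `I` of
`⟨ω⟩_I ⟨ω^{-1/(p-1)}⟩_I^{p-1}`. -/
noncomputable def apConst (p : ℝ) (ω : ℝ → ℝ≥0∞) : ℝ≥0∞ :=
  ⨆ (a : ℝ) (b : ℝ) (_ : a < b),
    avg (Icc a b) ω * avg (Icc a b) (fun x => ω x ^ (-(1 / (p - 1)))) ^ (p - 1)

/-- `ω` is an `A_p` weight. Local integrability follows from the finiteness of `[ω]_{A_p}`. -/
def IsApWeight (p : ℝ) (ω : ℝ → ℝ≥0∞) : Prop :=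
  AEMeasurable ω volume ∧ (∀ᵐ x, 0 < ω x ∧ ω x < ∞) ∧ apConst p ω < ∞

end SparseDom

/-! Everything rests on one local estimate. By Cauchy–Schwarz and the size condition, the sum of
`|a_I(f)| |a_I(g)|` over a collection below `I₀` is at most a constant times the two maximal tail
averages times `|I₀|` (`sum_enorm_mul_le`).

A stopping time makes this global. Below a maximal interval, stop where the tail average of `f` or
`g` jumps by a large factor. By a weak type inequality the stopping intervals fill at most half of
the interval, and the local estimate controls the unstopped part by the tail averages on top
(`IsNested.exists_sparse`, `four_mul_volume_tail_le`, `exists_sparse_tailAvg`).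

To remove the tails, `χ_I^M` is bounded by a geometric series of indicators of dilates of `I`, and
each dilate lies in a comparable cell of one of two grids (the one-third trick). For `M ≥ 3` the
decay beats the growth of the cells even in the product of two averages. The covering cells need not
be sparse, but with their weights they satisfy a Carleson packing condition, so a second stopping
time, on plain averages, yields a sparse family in a single grid (`sparseBound_of_cover`). The
resulting `SparseBound` is symmetric in the two functions and hence passes to the adjoint.

The remaining claims use only `SparseBound`. For weak type, the pairing is tested on a level set
minus the set where a dyadic maximal function is large. For weights and `p ≥ 2`, the `A_p`
characteristic is factored out of each term, the rest is moved to the disjoint sets `E Q`, and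
Doob's inequality is applied for each weight; `p < 2` follows by duality.

Half-open cells replace closed intervals throughout, so that two cells of a grid are exactly nested
or disjoint; the difference is a null set. -/

namespace SparseDom

/-! ### Geometry of the two dyadic grids -/

/-- The half-open version of `dyadic α i`. -/
noncomputable def cell (α : ℝ) (i : ℤ × ℤ) : Set ℝ :=
  Ico ((2 : ℝ) ^ (-i.1) * (i.2 + (-1) ^ i.1 * α)) ((2 : ℝ) ^ (-i.1) * (1 + i.2 + (-1) ^ i.1 * α))

theorem two_zpow_pos (k : ℤ) : (0 : ℝ) < 2 ^ k := by positivity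

theorem left_lt_right (α : ℝ) (i : ℤ × ℤ) :
    (2 : ℝ) ^ (-i.1) * (i.2 + (-1) ^ i.1 * α) < 2 ^ (-i.1) * (1 + i.2 + (-1) ^ i.1 * α) :=
  mul_lt_mul_of_pos_left (by linarith) (two_zpow_pos _)

theorem measurableSet_cell (α : ℝ) (i : ℤ × ℤ) : MeasurableSet (cell α i) := measurableSet_Ico

theorem cell_subset_dyadic (α : ℝ) (i : ℤ × ℤ) : cell α i ⊆ dyadic α i := Ico_subset_Icc_self

theorem cell_ae_eq_dyadic (α : ℝ) (i : ℤ × ℤ) : cell α i =ᵐ[volume] dyadic α i := Ico_ae_eq_Icc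

theorem volume_cell (α : ℝ) (i : ℤ × ℤ) : volume (cell α i) = ENNReal.ofReal (2 ^ (-i.1)) := by
  rw [cell, Real.volume_Ico]; congr 1; ring

theorem volume_dyadic (α : ℝ) (i : ℤ × ℤ) : volume (dyadic α i) = ENNReal.ofReal (2 ^ (-i.1)) := by
  rw [← measure_congr (cell_ae_eq_dyadic α i), volume_cell]

theorem volume_cell_ne_zero (α : ℝ) (i : ℤ × ℤ) : volume (cell α i) ≠ 0 := by
  rw [volume_cell]; simpa using two_zpow_pos _

theorem volume_cell_ne_top (α : ℝ) (i : ℤ × ℤ) : volume (cell α i) ≠ ∞ := by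
  rw [volume_cell]; exact ENNReal.ofReal_ne_top

theorem volumeReal_dyadic (α : ℝ) (i : ℤ × ℤ) : volume.real (dyadic α i) = 2 ^ (-i.1) := by
  rw [measureReal_def, volume_dyadic, ENNReal.toReal_ofReal (two_zpow_pos _).le]

theorem cell_subset_iff {α : ℝ} {i j : ℤ × ℤ} : cell α i ⊆ cell α j ↔ dyadic α i ⊆ dyadic α j := by
  rw [cell, cell, dyadic, dyadic, Ico_subset_Ico_iff (left_lt_right α i),
    Icc_subset_Icc_iff (left_lt_right α i).le]

theorem cell_injective (α : ℝ) : Function.Injective (cell α) := by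
  intro i j h
  have h1 : i.1 = j.1 := by
    have := congrArg volume h
    rw [volume_cell, volume_cell, ENNReal.ofReal_eq_ofReal_iff (two_zpow_pos _).le
      (two_zpow_pos _).le] at this
    have := zpow_right_injective₀ (by norm_num) (by norm_num) this
    simpa using this
  have h2 := ((Ico_subset_Ico_iff (left_lt_right α i)).1 h.le).1
  have h3 := ((Ico_subset_Ico_iff (left_lt_right α j)).1 h.ge).1
  rw [h1] at h2 h3
  have h4 := le_antisymm h2 h3
  have h5 := mul_left_cancel₀ (two_zpow_pos _).ne' h4
  have h6 : (i.2 : ℝ) = j.2 := by linarith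
  exact Prod.ext h1 (by exact_mod_cast h6)

theorem dyadic_injective (α : ℝ) : Function.Injective (dyadic α) := by
  intro i j h
  exact cell_injective α ((cell_subset_iff.2 h.le).antisymm (cell_subset_iff.2 h.ge))

theorem disjoint_cell {α : ℝ} {k m n : ℤ} (h : m ≠ n) :
    Disjoint (cell α (k, m)) (cell α (k, n)) := by
  wlog hmn : m < n generalizing m n
  · exact (this h.symm (lt_of_le_of_ne (not_lt.1 hmn) h.symm)).symm
  rw [Set.disjoint_left]
  intro x hx hy
  have h1 := hx.2
  have h2 := hy.1
  have h3 := lt_of_mul_lt_mul_left (h2.trans_lt h1) (two_zpow_pos _).le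
  have h4 : (m : ℝ) + 1 ≤ n := by exact_mod_cast hmn
  simp only at h3
  linarith

theorem neg_one_zpow_cases (k : ℤ) : ((-1 : ℝ) ^ k = 1) ∨ ((-1 : ℝ) ^ k = -1) := by
  rcases Int.even_or_odd k with h | h
  · exact Or.inl h.neg_one_zpow
  · exact Or.inr h.neg_one_zpow

theorem exists_parent {α : ℝ} (hα : ∃ n : ℤ, 3 * α = n) (k m : ℤ) :
    ∃ m', cell α (k + 1, m) ⊆ cell α (k, m') := by
  obtain ⟨n, hn⟩ := hα
  -- In units of the child length, the alternating sign displaces the child grid from the parent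
  -- grid by `3 (-1)^k α`. This is an integer, so parent endpoints are also child endpoints.
  have key : ∃ N : ℤ, (N : ℝ) = m - 3 * ((-1) ^ k * α) := by
    rcases neg_one_zpow_cases k with h | h
    · exact ⟨m - n, by rw [h]; push_cast; linarith⟩
    · exact ⟨m + n, by rw [h]; push_cast; linarith⟩
  obtain ⟨N, hN⟩ := key
  refine ⟨N / 2, ?_⟩
  have hr : (N : ℝ) = 2 * ((N / 2 : ℤ) : ℝ) + ((N % 2 : ℤ) : ℝ) := by
    exact_mod_cast (Int.mul_ediv_add_emod N 2).symm
  have hr0 : (0 : ℝ) ≤ ((N % 2 : ℤ) : ℝ) := by exact_mod_cast Int.emod_nonneg N (by norm_num)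
  have hr1 : ((N % 2 : ℤ) : ℝ) ≤ 1 := by
    exact_mod_cast Int.lt_add_one_iff.1 (Int.emod_lt_of_pos N (by norm_num))
  have hh : (2 : ℝ) ^ (-(k + 1)) = 2 ^ (-k) / 2 := by
    rw [neg_add, zpow_add₀ (by norm_num)]; norm_num; ring
  have he : (-1 : ℝ) ^ (k + 1) = -(-1) ^ k := by rw [zpow_add₀ (by norm_num)]; norm_num
  have hp := two_zpow_pos (-k)
  rw [cell, cell, Ico_subset_Ico_iff (left_lt_right α (k + 1, m))]
  simp only [hh, he]
  set e := (-1 : ℝ) ^ k * α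
  have e1 : -(-1 : ℝ) ^ k * α = -e := by simp [e]
  rw [e1]
  constructor
  · rw [div_mul_eq_mul_div, mul_div_assoc]
    exact mul_le_mul_of_nonneg_left (by linarith) hp.le
  · rw [div_mul_eq_mul_div, mul_div_assoc]
    exact mul_le_mul_of_nonneg_left (by linarith) hp.le

theorem exists_ancestor {α : ℝ} (hα : ∃ n : ℤ, 3 * α = n) (n : ℕ) (k m : ℤ) :
    ∃ m', cell α (k + n, m) ⊆ cell α (k, m') := by
  induction n generalizing m with
  | zero => exact ⟨m, by simp⟩
  | succ n ih =>
    obtain ⟨m₁, h₁⟩ := exists_parent hα (k + n) m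
    obtain ⟨m₂, h₂⟩ := ih m₁
    exact ⟨m₂, by push_cast; rw [← add_assoc]; exact h₁.trans h₂⟩

/-- A family of measurable sets any two of which are nested or disjoint. -/
structure IsNested {ι : Type*} (D : ι → Set ℝ) : Prop where
  measurable : ∀ i, MeasurableSet (D i)
  nested : ∀ i j, D i ⊆ D j ∨ D j ⊆ D i ∨ Disjoint (D i) (D j)

theorem isNested_cell {α : ℝ} (hα : ∃ n : ℤ, 3 * α = n) : IsNested (cell α) where
  measurable := measurableSet_cell α
  nested := by
    have key : ∀ i j : ℤ × ℤ, j.1 ≤ i.1 → cell α i ⊆ cell α j ∨ Disjoint (cell α i) (cell α j) := by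
      rintro ⟨k, m⟩ ⟨l, n⟩ hkl
      obtain ⟨r, hr⟩ := Int.le.dest hkl
      obtain ⟨m', h⟩ := exists_ancestor hα r l m
      simp only at hr
      rw [hr] at h
      by_cases hm : m' = n
      · exact Or.inl (hm ▸ h)
      · exact Or.inr ((disjoint_cell hm).mono_left h)
    intro i j
    rcases le_total j.1 i.1 with h | h
    · rcases key i j h with h | h
      · exact Or.inl h
      · exact Or.inr (Or.inr h)
    · rcases key j i h with h | h
      · exact Or.inr (Or.inl h)
      · exact Or.inr (Or.inr h.symm)

/-- The parameters of the two grids. -/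
noncomputable def shift (b : Bool) : ℝ := if b then 1 / 3 else 0

theorem isNested_shift (b : Bool) : IsNested (cell (shift b)) := by
  refine isNested_cell ?_
  cases b
  · exact ⟨0, by simp [shift]⟩
  · exact ⟨1, by simp [shift]⟩

/-- One-third trick. If `[u, v]` does not fit in a cell of the unshifted grid, it contains an
endpoint of that grid. At the same scale the endpoints of the shifted grid stay at distance at least
`1/3` of the cell length from it, and `3/16 < 1/3`. The parity of `n` decides on which side the
shift falls, hence which shifted cell contains `[u, v]`. -/
theorem exists_cell_of_short {n : ℤ} {u v : ℝ} (huv : v - u ≤ 3 / 16 * 2 ^ (-n)) :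
    ∃ b m, Icc u v ⊆ cell (shift b) (n, m) := by
  have hp := two_zpow_pos (-n)
  set h := (2 : ℝ) ^ (-n) with hh
  set m := ⌊u / h⌋ with hm
  have h1 : h * m ≤ u := by
    have := (le_div_iff₀ hp).1 (Int.floor_le (u / h)); linarith
  have h2 : u < h * (m + 1) := by
    have := (div_lt_iff₀ hp).1 (Int.lt_floor_add_one (u / h)); linarith
  by_cases hv : v < h * (m + 1)
  · refine ⟨false, m, fun x hx => ?_⟩
    simp only [cell, shift, ← hh, mem_Ico]
    constructor
    · simp; linarith [hx.1]
    · simp; linarith [hx.2]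
  · have hv' := not_lt.1 hv
    rcases neg_one_zpow_cases n with e | e
    · refine ⟨true, m, fun x hx => ?_⟩
      simp only [cell, shift, ← hh, mem_Ico, e, if_true]
      constructor
      · linarith [hx.1]
      · linarith [hx.2]
    · refine ⟨true, m + 1, fun x hx => ?_⟩
      simp only [cell, shift, ← hh, mem_Ico, e, if_true]
      push_cast
      constructor
      · linarith [hx.1]
      · linarith [hx.2]

/-- The points at distance at most `2^k |I|` from `I`. -/
def dilate (k : ℕ) (I : Set ℝ) : Set ℝ := {x | Metric.infDist x I ≤ 2 ^ k * volume.real I}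

/-- The dilate has length `(1 + 2^(k+1)) |I| ≤ 3 · 2^k |I|`, which is `3/16` of the length `2^(k+4)
|I|` of a cell of generation `i.1 - k - 4`. -/
theorem exists_cell_dilate (i : ℤ × ℤ) (k : ℕ) :
    ∃ b m, dilate k (interval i) ⊆ cell (shift b) (i.1 - k - 4, m) := by
  set a := (2 : ℝ) ^ (-i.1) * (i.2 + (-1) ^ i.1 * 0) with ha
  set h := (2 : ℝ) ^ (-i.1) with hh
  have hp : 0 < h := two_zpow_pos _
  have hI : interval i = Icc a (a + h) := by
    rw [interval, dyadic]; congr 1; simp only [ha, hh]; ring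
  have hk : (1 : ℝ) ≤ 2 ^ k := one_le_pow₀ (by norm_num)
  have hz : (2 : ℝ) ^ (-(i.1 - k - 4)) = 16 * (2 ^ k * h) := by
    rw [show -(i.1 - k - 4) = 4 + (k + -i.1) by ring, zpow_add₀ (by norm_num),
      zpow_add₀ (by norm_num)]
    norm_num [hh]
  obtain ⟨b, m, hb⟩ := exists_cell_of_short (n := i.1 - k - 4) (u := a - 2 ^ k * h)
    (v := a + h + 2 ^ k * h) (by rw [hz]; nlinarith)
  refine ⟨b, m, fun x hx => hb ?_⟩
  simp only [dilate, mem_ofPred_eq] at hx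
  rw [show volume.real (interval i) = h from volumeReal_dyadic 0 i] at hx
  have hne : (interval i).Nonempty := by rw [hI]; exact nonempty_Icc.2 (by linarith)
  have hc : IsCompact (interval i) := by rw [hI]; exact isCompact_Icc
  obtain ⟨y, hy, hxy⟩ := hc.exists_infDist_eq_dist hne x
  rw [hxy, Real.dist_eq, abs_le] at hx
  rw [hI] at hy
  exact ⟨by linarith [hy.1, hx.1], by linarith [hy.2, hx.2]⟩

theorem subset_dilate (k : ℕ) (I : Set ℝ) : I ⊆ dilate k I := fun x hx => by
  simp only [dilate, mem_ofPred_eq, Metric.infDist_zero_of_mem hx]; positivity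

theorem dilate_mono (I : Set ℝ) {k l : ℕ} (h : k ≤ l) : dilate k I ⊆ dilate l I := fun x hx =>
  le_trans hx (mul_le_mul_of_nonneg_right (pow_le_pow_right₀ (by norm_num) h) measureReal_nonneg)

theorem measurableSet_dilate (k : ℕ) (I : Set ℝ) : MeasurableSet (dilate k I) :=
  measurableSet_le (Metric.continuous_infDist_pt I).measurable measurable_const

/-! ### Covering lemma and principal intervals in nested families -/

section Stopping

variable {ι : Type*}

/-- The weak type inequality for finitely many members of a nested family. -/
theorem IsNested.weak_type {D : ι → Set ℝ} (hD : IsNested D) (μ : Measure ℝ) (h : ℝ → ℝ≥0∞)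
    {s : ℝ≥0∞} (G : Finset ι) (hG : ∀ j ∈ G, s * μ (D j) ≤ ∫⁻ x in D j, h x ∂μ) :
    s * μ (⋃ j ∈ G, D j) ≤ ∫⁻ x in ⋃ j ∈ G, D j, h x ∂μ := by
  classical
  induction G using Finset.strongInduction with
  | H G ih =>
    rcases G.eq_empty_or_nonempty with rfl | hne
    · simp
    -- A maximal member is disjoint from every member it does not contain. It can be peeled off
    -- without any covering constant.
    obtain ⟨i, hi, hmax⟩ := Finset.exists_maximalFor D G hne
    set G' := G.filter fun j => ¬ D j ⊆ D i with hG'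
    have hlt : G' ⊂ G := by
      refine Finset.filter_ssubset.2 ⟨i, hi, by simp⟩
    have hU : ⋃ j ∈ G, D j = D i ∪ ⋃ j ∈ G', D j := by
      apply Subset.antisymm
      · refine iUnion₂_subset fun j hj => ?_
        by_cases hji : D j ⊆ D i
        · exact hji.trans subset_union_left
        · exact (subset_biUnion_of_mem (u := D) (Finset.mem_coe.2
            (Finset.mem_filter.2 ⟨hj, hji⟩))).trans subset_union_right
      · refine union_subset (subset_biUnion_of_mem (u := D) hi) ?_
        exact biUnion_subset_biUnion_left fun j hj => (Finset.mem_filter.1 hj).1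
    have hdisj : Disjoint (D i) (⋃ j ∈ G', D j) := by
      rw [disjoint_iUnion₂_right]
      intro j hj
      obtain ⟨hj, hji⟩ := Finset.mem_filter.1 hj
      rcases hD.nested i j with h | h | h
      · exact absurd (hmax hj h) hji
      · exact absurd h hji
      · exact h
    have hm : MeasurableSet (⋃ j ∈ G', D j) :=
      Finset.measurableSet_biUnion _ fun j _ => hD.measurable j
    rw [hU, measure_union hdisj hm, lintegral_union hm hdisj, mul_add]
    exact add_le_add (hG i hi) (ih G' hlt fun j hj => hG j (Finset.mem_filter.1 hj).1)

/-- The principal intervals of a finite collection: if two functionals `A`, `B` of the intervals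
are large only on small sets, and `c` is controlled by `A B` on collections over which `A` and `B`
do not increase, then `c` is dominated by a sparse sum. -/
theorem IsNested.exists_sparse {D : ι → Set ℝ} (hD : IsNested D)
    (h0 : ∀ i, volume (D i) ≠ 0) (htop : ∀ i, volume (D i) ≠ ∞) (A B c : ι → ℝ≥0∞) (K L : ℝ≥0∞)
    (F : Finset ι)
    (h1 : ∀ i ∈ F, ∀ G ⊆ F, (∀ j ∈ G, D j ⊆ D i ∧ (K * A i < A j ∨ K * B i < B j)) →
      2 * volume (⋃ j ∈ G, D j) ≤ volume (D i))
    (h2 : ∀ i ∈ F, ∀ G ⊆ F, (∀ j ∈ G, D j ⊆ D i ∧ A j ≤ K * A i ∧ B j ≤ K * B i) →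
      ∑ j ∈ G, c j ≤ L * (A i * B i * volume (D i))) :
    ∃ S ⊆ F, ∃ E : ι → Set ℝ, (∀ i ∈ S, MeasurableSet (E i) ∧ E i ⊆ D i ∧
        volume (D i) ≤ 2 * volume (E i)) ∧ (S : Set ι).PairwiseDisjoint E ∧
      ∑ j ∈ F, c j ≤ L * ∑ i ∈ S, A i * B i * volume (D i) := by
  classical
  induction F using Finset.strongInduction with
  | H F ih =>
    rcases F.eq_empty_or_nonempty with rfl | hne
    · exact ⟨∅, by simp, fun _ => ∅, by simp, by simp, by simp⟩
    obtain ⟨i, hi, hmax⟩ := Finset.exists_maximalFor D F hne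
    set P := F.filter fun j => D j ⊆ D i ∧ (K * A i < A j ∨ K * B i < B j) with hP
    set U := ⋃ j ∈ P, D j with hU
    -- `G` is the part charged to `i`: the members below `D i` under no stopping set. The recursion
    -- runs on `F \ G`, whose members lie inside `U` or are disjoint from `D i`, so `D i \ U` is
    -- free to serve as `E i`.
    set G := F.filter fun j => D j ⊆ D i ∧ ∀ s ∈ P, ¬ D j ⊆ D s with hG
    have hPF : P ⊆ F := Finset.filter_subset _ _
    have hGF : G ⊆ F := Finset.filter_subset _ _
    have hPU : 2 * volume U ≤ volume (D i) :=
      h1 i hi P hPF fun j hj => (Finset.mem_filter.1 hj).2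
    have hUi : U ⊆ D i := iUnion₂_subset fun j hj => (Finset.mem_filter.1 hj).2.1
    have hUm : MeasurableSet U := Finset.measurableSet_biUnion _ fun j _ => hD.measurable j
    -- Otherwise `D i` would lie in a stopping set and `|D i| ≤ |U| ≤ |D i| / 2`. This makes the
    -- recursion strictly decrease.
    have hiG : i ∈ G := by
      refine Finset.mem_filter.2 ⟨hi, Subset.rfl, fun s hs his => ?_⟩
      have : volume (D i) ≤ volume U := measure_mono
        (his.trans (subset_biUnion_of_mem (u := D) (Finset.mem_coe.2 hs)))
      have h3 : volume (D i) + volume (D i) ≤ 0 + volume (D i) := by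
        rw [zero_add, ← two_mul]; exact (mul_le_mul_right this 2).trans hPU
      exact h0 i (le_zero_iff.1 (ENNReal.le_of_add_le_add_right (htop i) h3))
    have hlt : F \ G ⊂ F := Finset.sdiff_ssubset hGF ⟨i, hiG⟩
    obtain ⟨S, hSF, E, hE, hEd, hsum⟩ := ih (F \ G) hlt
      (fun j hj G' hG' => h1 j (hlt.1 hj) G' (hG'.trans hlt.1))
      (fun j hj G' hG' => h2 j (hlt.1 hj) G' (hG'.trans hlt.1))
    have hiS : i ∉ S := fun h => (Finset.mem_sdiff.1 (hSF h)).2 hiG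
    have hne' : ∀ j ∈ S, j ≠ i := fun j hj h => hiS (h ▸ hj)
    set E' : ι → Set ℝ := fun j => if j = i then D i \ U else E j with hE'
    have hE'i : E' i = D i \ U := by simp [hE']
    have hE'S : ∀ j ∈ S, E' j = E j := fun j hj => by simp [hE', hne' j hj]
    have hdis : ∀ j ∈ S, Disjoint (D i \ U) (E j) := by
      intro j hj
      obtain ⟨hjF, hjG⟩ := Finset.mem_sdiff.1 (hSF hj)
      refine Disjoint.mono_right (hE j hj).2.1 ?_
      by_cases hji : D j ⊆ D i
      · have : ∃ s ∈ P, D j ⊆ D s := by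
          by_contra! hcon
          exact hjG (Finset.mem_filter.2 ⟨hjF, hji, hcon⟩)
        obtain ⟨s, hs, hjs⟩ := this
        exact disjoint_sdiff_left.mono_right
          (hjs.trans (subset_biUnion_of_mem (u := D) (Finset.mem_coe.2 hs)))
      · rcases hD.nested i j with h | h | h
        · exact absurd (hmax hjF h) hji
        · exact absurd h hji
        · exact h.mono_left sdiff_subset
    refine ⟨insert i S, Finset.insert_subset hi (hSF.trans hlt.1), E', ?_, ?_, ?_⟩
    · intro j hj
      rcases Finset.mem_insert.1 hj with rfl | hj
      · rw [hE'i]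
        refine ⟨(hD.measurable j).diff hUm, sdiff_subset, ?_⟩
        rw [measure_sdiff hUi hUm.nullMeasurableSet (measure_ne_top_of_subset hUi (htop j)),
          ENNReal.mul_sub fun _ _ => ENNReal.ofNat_ne_top]
        refine ENNReal.le_sub_of_add_le_right ?_ ?_
        · exact ENNReal.mul_ne_top ENNReal.ofNat_ne_top (measure_ne_top_of_subset hUi (htop j))
        · rw [two_mul (volume (D j))]; gcongr
      · rw [hE'S j hj]; exact hE j hj
    · rw [Finset.coe_insert]
      refine PairwiseDisjoint.insert ?_ ?_
      · intro j hj k hk hjk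
        simp only [Function.onFun, hE'S j hj, hE'S k hk]
        exact hEd hj hk hjk
      · intro j hj _
        rw [hE'i, hE'S j hj]; exact hdis j hj
    · rw [Finset.sum_insert hiS, mul_add, ← Finset.sum_sdiff hGF, add_comm]
      refine add_le_add (h2 i hi G hGF fun j hj => ?_) hsum
      obtain ⟨hjF, hji, hjP⟩ := Finset.mem_filter.1 hj
      have : ¬ (K * A i < A j ∨ K * B i < B j) := fun h =>
        hjP j (Finset.mem_filter.2 ⟨hjF, hji, h⟩) Subset.rfl
      rw [not_or, not_lt, not_lt] at this
      exact ⟨hji, this⟩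

end Stopping

/-! ### Maximal inequalities -/

/-- Absorption: the factor `X ^ (1 / q)` is divided out, which is legitimate only because `X` is
finite. Every use below therefore comes with an a priori finiteness or a truncation. -/
theorem le_rpow_of_le_mul_rpow {p q : ℝ} (hpq : p.HolderConjugate q) {X Y : ℝ≥0∞} (hX : X ≠ ∞)
    (h : X ≤ Y * X ^ (1 / q)) : X ≤ Y ^ p := by
  rcases eq_or_ne X 0 with rfl | h0
  · exact zero_le
  have hp := hpq.pos
  have hq := hpq.symm.pos
  have e : X = X ^ (1 / p) * X ^ (1 / q) := by
    rw [← ENNReal.rpow_add _ _ h0 hX, one_div, one_div, hpq.inv_add_inv_eq_one, ENNReal.rpow_one]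
  have h1 : X ^ (1 / q) ≠ 0 := by simp [h0, hX]
  have h2 : X ^ (1 / q) ≠ ∞ := ENNReal.rpow_ne_top_of_nonneg (by positivity) hX
  have h3 : X ^ (1 / p) ≤ Y := by
    refine (ENNReal.mul_le_mul_iff_left h1 h2).1 ?_
    rwa [← e]
  calc X = (X ^ (1 / p)) ^ p := by
        rw [← ENNReal.rpow_mul, one_div_mul_cancel hp.ne', ENNReal.rpow_one]
    _ ≤ Y ^ p := ENNReal.rpow_le_rpow h3 hp.le

/-- Doob's inequality, in integrated form. -/
theorem lintegral_rpow_le_of_weak_type {μ : Measure ℝ} {m : ℝ → ℝ} (hm0 : ∀ x, 0 ≤ m x)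
    (hm : Measurable m) {h : ℝ → ℝ≥0∞} (hh : AEMeasurable h μ)
    (hw : ∀ s : ℝ, 0 < s → ENNReal.ofReal s * μ {x | s < m x} ≤ ∫⁻ x in {x | s < m x}, h x ∂μ)
    {p : ℝ} (hp : 1 < p) :
    ∫⁻ x, ENNReal.ofReal (m x ^ p) ∂μ ≤
      ENNReal.ofReal (p / (p - 1)) * ∫⁻ x, h x * ENNReal.ofReal (m x ^ (p - 1)) ∂μ := by
  have hp1 : 0 < p - 1 := by linarith
  -- Regarding the right side as an integral against `h dμ` gives both sides a layer-cake formula,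
  -- and the weak type hypothesis compares the two integrands at each level `t`.
  have e2 : ∫⁻ x, h x * ENNReal.ofReal (m x ^ (p - 1)) ∂μ =
      ∫⁻ x, ENNReal.ofReal (m x ^ (p - 1)) ∂(μ.withDensity h) := by
    rw [lintegral_withDensity_eq_lintegral_mul₀ hh (by fun_prop)]; rfl
  rw [e2, lintegral_rpow_eq_lintegral_meas_lt_mul μ (Filter.Eventually.of_forall hm0)
    hm.aemeasurable (by linarith : 0 < p), lintegral_rpow_eq_lintegral_meas_lt_mul _
    (Filter.Eventually.of_forall hm0) hm.aemeasurable hp1, ← mul_assoc,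
    ← ENNReal.ofReal_mul (by positivity), div_mul_cancel₀ _ hp1.ne']
  refine mul_le_mul_right (setLIntegral_mono' measurableSet_Ioi fun t ht => ?_) _
  have ht0 : 0 < t := ht
  have e3 : t ^ (p - 1) = t * t ^ (p - 1 - 1) := by
    rw [← Real.rpow_one_add' ht0.le (by linarith)]; congr 1; ring
  rw [e3, ENNReal.ofReal_mul ht0.le, ← mul_assoc, mul_comm (μ _),
    withDensity_apply _ (measurableSet_lt measurable_const hm)]
  exact mul_le_mul_left (hw t ht0) _

section Maximal

variable {ι : Type*}

/-- The maximal function of the averages `b` over a finite collection. -/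
noncomputable def maximalFn (D : ι → Set ℝ) (S : Finset ι) (b : ι → ℝ≥0) (x : ℝ) : ℝ≥0 :=
  S.sup fun j => (D j).indicator (fun _ => b j) x

theorem measurable_maximalFn {D : ι → Set ℝ} (hD : ∀ i, MeasurableSet (D i)) (S : Finset ι)
    (b : ι → ℝ≥0) : Measurable (maximalFn D S b) := by
  classical
  induction S using Finset.induction_on with
  | empty => exact measurable_const
  | insert i S _ ih =>
    have : maximalFn D (insert i S) b =
        fun x => (D i).indicator (fun _ => b i) x ⊔ maximalFn D S b x :=
      funext fun x => Finset.sup_insert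
    rw [this]
    exact (measurable_const.indicator (hD i)).sup ih

theorem le_maximalFn {D : ι → Set ℝ} {S : Finset ι} (b : ι → ℝ≥0) {j : ι} (hj : j ∈ S) {x : ℝ}
    (hx : x ∈ D j) : b j ≤ maximalFn D S b x := by
  have := Finset.le_sup (f := fun j => (D j).indicator (fun _ => b j) x) hj
  rw [indicator_of_mem hx] at this
  exact this

/-- The superlevel set is exactly the union of the `D j` with `b j > s`, so the covering lemma
applies with constant one. -/
theorem maximalFn_weak_type {D : ι → Set ℝ} (hD : IsNested D) (μ : Measure ℝ) (S : Finset ι)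
    (b : ι → ℝ≥0) (h : ℝ → ℝ≥0∞) (hb : ∀ j ∈ S, b j * μ (D j) ≤ ∫⁻ x in D j, h x ∂μ)
    (s : ℝ) (hs : 0 < s) :
    ENNReal.ofReal s * μ {x | s < maximalFn D S b x} ≤
      ∫⁻ x in {x | s < maximalFn D S b x}, h x ∂μ := by
  classical
  have hset : {x | s < maximalFn D S b x} = ⋃ j ∈ S.filter fun j => s < b j, D j := by
    ext x
    lift s to ℝ≥0 using hs.le
    have h0 : 0 < s := by exact_mod_cast hs
    simp only [mem_ofPred_eq, NNReal.coe_lt_coe, maximalFn, mem_iUnion, Finset.mem_filter]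
    rw [Finset.lt_sup_iff]
    constructor
    · rintro ⟨j, hj, hlt⟩
      by_cases hx : x ∈ D j
      · exact ⟨j, ⟨hj, by simpa [hx] using hlt⟩, hx⟩
      · simp [hx] at hlt
    · rintro ⟨j, ⟨hj, hlt⟩, hx⟩
      exact ⟨j, hj, by simpa [hx] using hlt⟩
  rw [hset]
  refine hD.weak_type μ h _ fun j hj => ?_
  obtain ⟨hj, hlt⟩ := Finset.mem_filter.1 hj
  refine le_trans (mul_le_mul_left ?_ _) (hb j hj)
  rw [← ENNReal.ofReal_coe_nnreal]
  exact ENNReal.ofReal_le_ofReal hlt.le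

theorem sum_rpow_le_lintegral_maximalFn {D : ι → Set ℝ} (μ : Measure ℝ) (S : Finset ι) (b : ι → ℝ≥0) {E : ι → Set ℝ}
    (hE : ∀ j ∈ S, MeasurableSet (E j) ∧ E j ⊆ D j) (hEd : (S : Set ι).PairwiseDisjoint E)
    {p : ℝ} (hp : 0 ≤ p) :
    ∑ j ∈ S, (b j : ℝ≥0∞) ^ p * μ (E j) ≤
      ∫⁻ x, ENNReal.ofReal ((maximalFn D S b x : ℝ) ^ p) ∂μ := by
  calc ∑ j ∈ S, (b j : ℝ≥0∞) ^ p * μ (E j)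
      ≤ ∑ j ∈ S, ∫⁻ x in E j, ENNReal.ofReal ((maximalFn D S b x : ℝ) ^ p) ∂μ := by
        refine Finset.sum_le_sum fun j hj => ?_
        rw [← setLIntegral_const]
        refine setLIntegral_mono' (hE j hj).1 fun x hx => ?_
        rw [← ENNReal.ofReal_rpow_of_nonneg NNReal.zero_le_coe hp, ENNReal.ofReal_coe_nnreal]
        exact ENNReal.rpow_le_rpow (by exact_mod_cast le_maximalFn b hj ((hE j hj).2 hx)) hp
    _ = ∫⁻ x in ⋃ j ∈ S, E j, ENNReal.ofReal ((maximalFn D S b x : ℝ) ^ p) ∂μ :=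
        (lintegral_biUnion_finset hEd (fun j hj => (hE j hj).1) _).symm
    _ ≤ _ := setLIntegral_le_lintegral _ _

/-- The `L²` bound from `L¹` data needed for weak type: Doob at `p = 2` gives `∫ m² ≤ 2 ∫ h m`, and
`m ≤ l` pointwise. -/
theorem sum_sq_le_of_le {D : ι → Set ℝ} (hD : IsNested D) (μ : Measure ℝ) (S : Finset ι)
    (b : ι → ℝ≥0) {h : ℝ → ℝ≥0∞} (hh : AEMeasurable h μ)
    (hb : ∀ j ∈ S, b j * μ (D j) ≤ ∫⁻ x in D j, h x ∂μ) {E : ι → Set ℝ}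
    (hE : ∀ j ∈ S, MeasurableSet (E j) ∧ E j ⊆ D j) (hEd : (S : Set ι).PairwiseDisjoint E)
    {l : ℝ≥0} (hl : ∀ j ∈ S, b j ≤ l) :
    ∑ j ∈ S, (b j : ℝ≥0∞) ^ (2 : ℝ) * μ (E j) ≤ 2 * (l * ∫⁻ x, h x ∂μ) := by
  refine (sum_rpow_le_lintegral_maximalFn μ S b hE hEd zero_le_two).trans ?_
  refine (lintegral_rpow_le_of_weak_type (fun x => NNReal.coe_nonneg _)
    (measurable_maximalFn hD.measurable S b).coe_nnreal_real hh
    (maximalFn_weak_type hD μ S b h hb) one_lt_two).trans ?_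
  have e : ENNReal.ofReal (2 / (2 - 1)) = 2 := by norm_num
  rw [e]
  refine mul_le_mul_right ?_ _
  rw [← lintegral_const_mul'' _ hh]
  refine lintegral_mono fun x => ?_
  rw [mul_comm]
  refine mul_le_mul_left ?_ _
  norm_num
  refine Finset.sup_le fun j hj => ?_
  by_cases hx : x ∈ D j <;> simp [hx, hl j hj]

/-- Since the `E j` are disjoint, the sum is at most the integral of the `p`-th power of the maximal
function. Doob, Hölder and absorption then give the constant `q = p / (p - 1)`. -/
theorem sum_rpow_le {D : ι → Set ℝ} (hD : IsNested D) (μ : Measure ℝ) (S : Finset ι)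
    (hfin : ∀ j ∈ S, μ (D j) ≠ ∞)
    (b : ι → ℝ≥0) {h : ℝ → ℝ≥0∞} (hh : AEMeasurable h μ)
    (hb : ∀ j ∈ S, b j * μ (D j) ≤ ∫⁻ x in D j, h x ∂μ) {E : ι → Set ℝ}
    (hE : ∀ j ∈ S, MeasurableSet (E j) ∧ E j ⊆ D j) (hEd : (S : Set ι).PairwiseDisjoint E)
    {p q : ℝ} (hpq : p.HolderConjugate q) :
    ∑ j ∈ S, (b j : ℝ≥0∞) ^ p * μ (E j) ≤ ENNReal.ofReal q ^ p * ∫⁻ x, h x ^ p ∂μ := by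
  have hp0 := hpq.pos
  have hq0 := hpq.symm.pos
  have hp1 := hpq.lt
  refine (sum_rpow_le_lintegral_maximalFn μ S b hE hEd hp0.le).trans ?_
  set m : ℝ → ℝ := fun x => maximalFn D S b x with hm
  have hmm : Measurable m := (measurable_maximalFn hD.measurable S b).coe_nnreal_real
  have hm0 : ∀ x, 0 ≤ m x := fun x => NNReal.coe_nonneg _
  have h1 := lintegral_rpow_le_of_weak_type hm0 hmm hh (maximalFn_weak_type hD μ S b h hb) hp1
  -- Absorption requires this: the maximal function is bounded by a finite sum of multiples of
  -- indicators of sets of finite measure.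
  have hfinite : ∫⁻ x, ENNReal.ofReal (m x ^ p) ∂μ ≠ ∞ := by
    have hle : ∀ x, ENNReal.ofReal (m x ^ p) ≤
        ∑ j ∈ S, (D j).indicator (fun _ => (b j : ℝ≥0∞) ^ p) x := by
      intro x
      rw [← ENNReal.ofReal_rpow_of_nonneg (hm0 x) hp0.le, hm, ENNReal.ofReal_coe_nnreal]
      rcases S.eq_empty_or_nonempty with rfl | hne
      · simp [maximalFn, hp0]
      obtain ⟨j, hj, hje⟩ := Finset.exists_mem_eq_sup S hne
        fun j => (D j).indicator (fun _ => b j) x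
      rw [maximalFn, hje]
      refine le_trans ?_ (Finset.single_le_sum
        (f := fun j => (D j).indicator (fun _ => (b j : ℝ≥0∞) ^ p) x) (fun _ _ => zero_le) hj)
      by_cases hx : x ∈ D j <;> simp [hx, hp0]
    refine ne_top_of_le_ne_top ?_ (lintegral_mono hle)
    rw [lintegral_finsetSum _ fun j _ => measurable_const.indicator (hD.measurable j)]
    refine ENNReal.sum_ne_top.2 fun j hj => ?_
    rw [lintegral_indicator (hD.measurable j), setLIntegral_const]
    exact ENNReal.mul_ne_top (ENNReal.rpow_ne_top_of_nonneg hp0.le ENNReal.coe_ne_top) (hfin j hj)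
  have e : p / (p - 1) = q := hpq.conjugate_eq.symm
  rw [e] at h1
  have h2 := ENNReal.lintegral_mul_le_Lp_mul_Lq μ hpq hh
    (g := fun x => ENNReal.ofReal (m x ^ (p - 1))) (by fun_prop)
  have e2 : ∀ x, ENNReal.ofReal (m x ^ (p - 1)) ^ q = ENNReal.ofReal (m x ^ p) := fun x => by
    rw [ENNReal.ofReal_rpow_of_nonneg (Real.rpow_nonneg (hm0 x) _) hq0.le, ← Real.rpow_mul (hm0 x),
      hpq.sub_one_mul_conj]
  simp only [e2, Pi.mul_apply] at h2
  have h3 : ∫⁻ x, ENNReal.ofReal (m x ^ p) ∂μ ≤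
      (ENNReal.ofReal q * (∫⁻ x, h x ^ p ∂μ) ^ (1 / p)) *
        (∫⁻ x, ENNReal.ofReal (m x ^ p) ∂μ) ^ (1 / q) := by
    rw [mul_assoc]; exact h1.trans (mul_le_mul_right h2 _)
  have h4 := le_rpow_of_le_mul_rpow hpq hfinite h3
  rwa [ENNReal.mul_rpow_of_nonneg _ _ hp0.le, ← ENNReal.rpow_mul, one_div_mul_cancel hp0.ne',
    ENNReal.rpow_one] at h4

end Maximal

theorem avg_congr_set {P Q : Set ℝ} (hPQ : P =ᵐ[volume] Q) (h : ℝ → ℝ≥0∞) : avg P h = avg Q h := by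
  rw [avg, avg, measure_congr hPQ, setLIntegral_congr hPQ]

theorem avg_mul_volume {Q : Set ℝ} (h0 : volume Q ≠ 0) (ht : volume Q ≠ ∞) (h : ℝ → ℝ≥0∞) :
    avg Q h * volume Q = ∫⁻ x in Q, h x := by
  rw [avg, mul_comm, ← mul_assoc, ENNReal.mul_inv_cancel h0 ht, one_mul]

/-! ### Tail averages and their stopping intervals -/

section Tail

/-- The average `|I|⁻¹ ∫ h χ_I^M`. -/
noncomputable def tailAvg (M : ℕ) (I : Set ℝ) (h : ℝ → ℝ≥0∞) : ℝ≥0∞ :=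
  (volume I)⁻¹ * ∫⁻ x, h x * ENNReal.ofReal (chi I x ^ M)

theorem chi_nonneg (I : Set ℝ) (x : ℝ) : 0 ≤ chi I x :=
  inv_nonneg.2 (add_nonneg zero_le_one (div_nonneg Metric.infDist_nonneg measureReal_nonneg))

theorem chi_le_one (I : Set ℝ) (x : ℝ) : chi I x ≤ 1 :=
  inv_le_one_of_one_le₀ (le_add_of_nonneg_right
    (div_nonneg Metric.infDist_nonneg measureReal_nonneg))

theorem measurable_chi (I : Set ℝ) : Measurable (chi I) :=
  (((Metric.continuous_infDist_pt I).measurable.div_const _).const_add _).inv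

theorem locAvg_eq_tailAvg {𝕜 : Type*} [RCLike 𝕜] (M : ℕ) (I : Set ℝ) (f : ℝ → 𝕜) :
    locAvg M I f = tailAvg M I fun x => ‖f x‖ₑ := by
  rw [locAvg, locNorm, tailAvg, eLpNorm_one_eq_lintegral_enorm]
  congr 1
  refine lintegral_congr fun x => ?_
  rw [enorm_mul, enorm_norm, Real.enorm_of_nonneg (pow_nonneg (chi_nonneg I x) M)]

theorem volumeReal_interval (i : ℤ × ℤ) : volume.real (interval i) = 2 ^ (-i.1) :=
  volumeReal_dyadic 0 i

theorem volume_interval (i : ℤ × ℤ) : volume (interval i) = volume (cell 0 i) := by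
  rw [volume_cell]; exact volume_dyadic 0 i

theorem volume_interval_ne_zero (i : ℤ × ℤ) : volume (interval i) ≠ 0 :=
  volume_interval i ▸ volume_cell_ne_zero 0 i

theorem volume_interval_ne_top (i : ℤ × ℤ) : volume (interval i) ≠ ∞ :=
  volume_interval i ▸ volume_cell_ne_top 0 i

theorem interval_nonempty (i : ℤ × ℤ) : (interval i).Nonempty :=
  nonempty_Icc.2 (left_lt_right 0 i).le

theorem exists_mem_dilate {I : Set ℝ} (hI : 0 < volume.real I) (x : ℝ) : ∃ k, x ∈ dilate k I := by
  obtain ⟨k, hk⟩ := pow_unbounded_of_one_lt (Metric.infDist x I / volume.real I) one_lt_two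
  exact ⟨k, ((div_lt_iff₀ hI).1 hk).le⟩

/-- Let `n` be the first index with `x ∈ dilate n I`. Being outside the previous dilate gives `chi I
x ≤ 2^(1-n)`; the factor `2^M` pays for this shift by one, and also covers `n = 0`. -/
theorem ofReal_chi_pow_le {I : Set ℝ} (hI : 0 < volume.real I) (M : ℕ) (x : ℝ) :
    ENNReal.ofReal (chi I x ^ M) ≤
      2 ^ M * ∑' k : ℕ, ((2⁻¹ : ℝ≥0∞) ^ M) ^ k * (dilate k I).indicator 1 x := by
  classical
  have hex := exists_mem_dilate hI x
  set n := Nat.find hex with hn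
  have hmem : x ∈ dilate n I := Nat.find_spec hex
  have hle : ((2⁻¹ : ℝ≥0∞) ^ M) ^ n ≤
      ∑' k : ℕ, ((2⁻¹ : ℝ≥0∞) ^ M) ^ k * (dilate k I).indicator 1 x := by
    refine le_trans ?_ (ENNReal.le_tsum n)
    simp [hmem]
  refine le_trans ?_ (mul_le_mul_right hle _)
  rcases Nat.eq_zero_or_eq_succ_pred n with h0 | h1
  · rw [h0, pow_zero, mul_one]
    refine le_trans (ENNReal.ofReal_le_one.2 (pow_le_one₀ (chi_nonneg I x) (chi_le_one I x))) ?_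
    exact one_le_pow₀ one_le_two
  · set m := n.pred with hm
    have hnot : x ∉ dilate m I := Nat.find_min hex (by rw [← hn, h1]; exact Nat.lt_succ_self _)
    have hd : 2 ^ m * volume.real I < Metric.infDist x I := not_le.1 hnot
    have hc : chi I x ≤ (2⁻¹ : ℝ) ^ m := by
      rw [inv_pow]
      refine inv_anti₀ (by positivity) ?_
      have := (lt_div_iff₀ hI).2 hd
      linarith
    have h2 : ENNReal.ofReal ((2⁻¹ : ℝ) ^ m) = (2⁻¹ : ℝ≥0∞) ^ m := by
      rw [ENNReal.ofReal_pow (by positivity), ENNReal.ofReal_inv_of_pos two_pos]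
      norm_num
    calc ENNReal.ofReal (chi I x ^ M) = ENNReal.ofReal (chi I x) ^ M :=
          ENNReal.ofReal_pow (chi_nonneg I x) M
      _ ≤ ((2⁻¹ : ℝ≥0∞) ^ m) ^ M := by
          rw [← h2]; gcongr
      _ = 2 ^ M * ((2⁻¹ : ℝ≥0∞) ^ M) ^ n := by
          rw [h1, Nat.succ_eq_add_one, pow_succ, mul_comm _ ((2⁻¹ : ℝ≥0∞) ^ M), ← mul_assoc,
            ← mul_pow, ENNReal.mul_inv_cancel two_ne_zero ENNReal.ofNat_ne_top, one_pow, one_mul,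
            ← pow_mul, ← pow_mul, mul_comm]

theorem tailAvg_le_tsum {I : Set ℝ} (hI : 0 < volume.real I) (M : ℕ) {h : ℝ → ℝ≥0∞}
    (hh : AEMeasurable h volume) :
    tailAvg M I h ≤ 2 ^ M * ((volume I)⁻¹ *
      ∑' k : ℕ, ((2⁻¹ : ℝ≥0∞) ^ M) ^ k * ∫⁻ x in dilate k I, h x) := by
  rw [tailAvg, ← mul_assoc, mul_comm _ (volume I)⁻¹, mul_assoc]
  refine mul_le_mul_right ?_ _
  have e : ∀ k : ℕ, ((2⁻¹ : ℝ≥0∞) ^ M) ^ k * ∫⁻ x in dilate k I, h x =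
      ∫⁻ x, h x * (((2⁻¹ : ℝ≥0∞) ^ M) ^ k * (dilate k I).indicator 1 x) := by
    intro k
    rw [← lintegral_indicator (measurableSet_dilate k I),
      ← lintegral_const_mul'' _ (hh.indicator (measurableSet_dilate k I))]
    refine lintegral_congr fun x => ?_
    by_cases hx : x ∈ dilate k I <;> simp [hx, mul_comm]
  simp_rw [e]
  rw [← lintegral_tsum, ← lintegral_const_mul'']
  · refine lintegral_mono fun x => ?_
    simp only
    rw [ENNReal.tsum_mul_left, ← mul_assoc, mul_comm (2 ^ M) (h x), mul_assoc]
    exact mul_le_mul_right (ofReal_chi_pow_le hI M x) _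
  · refine AEMeasurable.tsum fun k => ?_
    exact hh.mul ((measurable_one.indicator (measurableSet_dilate k I)).const_mul _).aemeasurable
  · exact fun k =>
      hh.mul ((measurable_one.indicator (measurableSet_dilate k I)).const_mul _).aemeasurable

/-- A grid and an index of that grid whose cell contains the dilate of a dyadic interval. -/
noncomputable def coverGrid (i : ℤ × ℤ) (k : ℕ) : Bool := (exists_cell_dilate i k).choose

/-- The index of a cell that contains the dilate of a dyadic interval. -/
noncomputable def coverIndex (i : ℤ × ℤ) (k : ℕ) : ℤ × ℤ :=
  (i.1 - k - 4, (exists_cell_dilate i k).choose_spec.choose)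

theorem dilate_subset_cell (i : ℤ × ℤ) (k : ℕ) :
    dilate k (interval i) ⊆ cell (shift (coverGrid i k)) (coverIndex i k) :=
  (exists_cell_dilate i k).choose_spec.choose_spec

theorem volume_coverIndex (α : ℝ) (i : ℤ × ℤ) (k : ℕ) :
    volume (cell α (coverIndex i k)) = 16 * 2 ^ k * volume (interval i) := by
  rw [volume_interval, volume_cell, volume_cell, coverIndex]
  have : (2 : ℝ) ^ (-(i.1 - k - 4)) = 16 * 2 ^ k * 2 ^ (-i.1) := by
    rw [show -(i.1 - k - 4) = 4 + (k + -i.1) by ring, zpow_add₀ (by norm_num),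
      zpow_add₀ (by norm_num), ← mul_assoc]
    norm_num
  rw [this, ENNReal.ofReal_mul (by positivity), ENNReal.ofReal_mul (by positivity),
    ENNReal.ofReal_pow (by positivity)]
  norm_num

theorem inv_volume_mul_lintegral_dilate_le (i : ℤ × ℤ) (k : ℕ) (h : ℝ → ℝ≥0∞) :
    (volume (interval i))⁻¹ * ∫⁻ x in dilate k (interval i), h x ≤
      16 * 2 ^ k * avg (cell (shift (coverGrid i k)) (coverIndex i k)) h := by
  set v := volume (interval i)
  have hv0 : v ≠ 0 := volume_interval_ne_zero i
  have hvt : v ≠ ∞ := volume_interval_ne_top i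
  have h16 : (16 * 2 ^ k : ℝ≥0∞) ≠ 0 := by positivity
  have h16t : (16 * 2 ^ k : ℝ≥0∞) ≠ ∞ := by finiteness
  rw [avg, volume_coverIndex, ENNReal.mul_inv (Or.inl h16) (Or.inl h16t), mul_assoc (16 * 2 ^ k)⁻¹,
    ← mul_assoc, ENNReal.mul_inv_cancel h16 h16t, one_mul]
  exact mul_le_mul_right (lintegral_mono_set (dilate_subset_cell i k)) _

theorem two_mul_inv_two_pow_le {M : ℕ} (hM : 2 ≤ M) : (2⁻¹ : ℝ≥0∞) ^ M * 2 ≤ 2⁻¹ := by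
  calc (2⁻¹ : ℝ≥0∞) ^ M * 2 ≤ (2⁻¹ : ℝ≥0∞) ^ 2 * 2 := by
        refine mul_le_mul_left (pow_le_pow_right_of_le_one' ?_ hM) _
        exact ENNReal.inv_le_one.2 one_le_two
    _ = 2⁻¹ := by
        rw [pow_two, mul_assoc, ENNReal.inv_mul_cancel two_ne_zero ENNReal.ofNat_ne_top, mul_one]

/-- Passing from the `k`-th dilate to its covering cell costs `16 · 2^k`, while the tail contributes
`2^(-Mk)`. For `M ≥ 2` the series is dominated by a geometric one with sum `2`, whence `32`. -/
theorem tailAvg_le_of_avg_le {M : ℕ} (hM : 2 ≤ M) (i : ℤ × ℤ) {h : ℝ → ℝ≥0∞}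
    (hh : AEMeasurable h volume) {s : ℝ≥0∞}
    (hs : ∀ k, avg (cell (shift (coverGrid i k)) (coverIndex i k)) h ≤ s) :
    tailAvg M (interval i) h ≤ 2 ^ M * 32 * s := by
  have hI : 0 < volume.real (interval i) := by rw [volumeReal_interval]; positivity
  refine (tailAvg_le_tsum hI M hh).trans ?_
  rw [← ENNReal.tsum_mul_left, mul_assoc]
  refine mul_le_mul_right ?_ _
  calc ∑' k : ℕ, (volume (interval i))⁻¹ * (((2⁻¹ : ℝ≥0∞) ^ M) ^ k *
        ∫⁻ x in dilate k (interval i), h x)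
      ≤ ∑' k : ℕ, (2⁻¹ : ℝ≥0∞) ^ k * (16 * s) := by
        refine ENNReal.tsum_le_tsum fun k => ?_
        rw [mul_left_comm]
        calc ((2⁻¹ : ℝ≥0∞) ^ M) ^ k * ((volume (interval i))⁻¹ *
              ∫⁻ x in dilate k (interval i), h x)
            ≤ ((2⁻¹ : ℝ≥0∞) ^ M) ^ k * (16 * 2 ^ k * s) := by
              refine mul_le_mul_right ((inv_volume_mul_lintegral_dilate_le i k h).trans ?_) _
              exact mul_le_mul_right (hs k) _
          _ = ((2⁻¹ : ℝ≥0∞) ^ M * 2) ^ k * (16 * s) := by rw [mul_pow]; ring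
          _ ≤ _ := by gcongr; exact two_mul_inv_two_pow_le hM
    _ = 32 * s := by
        rw [ENNReal.tsum_mul_right, ENNReal.tsum_geometric, ENNReal.one_sub_inv_two, inv_inv,
          ← mul_assoc]
        norm_num

/-- The tails of a small interval are controlled by those of a large one, far from the latter. -/
theorem inv_volume_mul_chi_le {i j : ℤ × ℤ} (hji : interval j ⊆ interval i) {M : ℕ} (hM : 1 ≤ M)
    {x : ℝ} (hx : x ∉ dilate 0 (interval i)) :
    (volume (interval j))⁻¹ * ENNReal.ofReal (chi (interval j) x ^ M) ≤
      2 ^ M * ((volume (interval i))⁻¹ * ENNReal.ofReal (chi (interval i) x ^ M)) := by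
  set u := volume.real (interval j) with hu
  set v := volume.real (interval i) with hv
  have hu0 : 0 < u := by rw [hu, volumeReal_interval]; positivity
  have hv0 : 0 < v := by rw [hv, volumeReal_interval]; positivity
  have huv : u ≤ v := measureReal_mono hji (volume_interval_ne_top i)
  have hd : Metric.infDist x (interval i) ≤ Metric.infDist x (interval j) :=
    Metric.infDist_le_infDist_of_subset hji (interval_nonempty j)
  have hd0 : v < Metric.infDist x (interval i) := by
    have : ¬ Metric.infDist x (interval i) ≤ 2 ^ 0 * volume.real (interval i) := hx
    simpa using this
  set d := Metric.infDist x (interval i) with hdd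
  set d' := Metric.infDist x (interval j) with hdd'
  have hdp : 0 < d := hv0.trans hd0
  have hdp' : 0 < d' := hdp.trans_le hd
  have hj : volume (interval j) = ENNReal.ofReal u := by
    rw [hu, measureReal_def, ENNReal.ofReal_toReal (volume_interval_ne_top j)]
  have hi : volume (interval i) = ENNReal.ofReal v := by
    rw [hv, measureReal_def, ENNReal.ofReal_toReal (volume_interval_ne_top i)]
  have h2 : (2 : ℝ≥0∞) ^ M = ENNReal.ofReal (2 ^ M) := by
    rw [ENNReal.ofReal_pow zero_le_two]; norm_num
  rw [hj, hi, ← ENNReal.ofReal_inv_of_pos hu0, ← ENNReal.ofReal_inv_of_pos hv0, h2,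
    ← ENNReal.ofReal_mul (by positivity), ← ENNReal.ofReal_mul (by positivity),
    ← ENNReal.ofReal_mul (by positivity)]
  refine ENNReal.ofReal_le_ofReal ?_
  have hcj : chi (interval j) x ≤ u / d := by
    rw [chi, ← hu, ← hdd', inv_le_comm₀ (by positivity) (by positivity), inv_div]
    have := div_le_div_of_nonneg_right hd hu0.le
    linarith
  have hci : v / d ≤ 2 * chi (interval i) x := by
    have h1 : 1 ≤ d / v := (one_le_div hv0).2 hd0.le
    rw [chi, ← hv, ← hdd, ← div_eq_mul_inv, le_div_iff₀ (by positivity)]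
    have : v / d * (d / v) = 1 := by field_simp
    have h3 : v / d ≤ 1 := (div_le_one (by linarith)).2 hd0.le
    nlinarith
  -- One of the `M` powers is spent on the normalization by length. What remains, `(u / d)^m / d`,
  -- increases with `u`, so the larger interval wins.
  obtain ⟨m, rfl⟩ : ∃ m, M = m + 1 := ⟨M - 1, by omega⟩
  calc u⁻¹ * chi (interval j) x ^ (m + 1) ≤ u⁻¹ * (u / d) ^ (m + 1) := by
        have := chi_nonneg (interval j) x
        gcongr
    _ = (u / d) ^ m / d := by rw [pow_succ]; field_simp
    _ ≤ (v / d) ^ m / d := by gcongr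
    _ = v⁻¹ * (v / d) ^ (m + 1) := by rw [pow_succ]; field_simp
    _ ≤ v⁻¹ * (2 * chi (interval i) x) ^ (m + 1) := by gcongr
    _ = 2 ^ (m + 1) * (v⁻¹ * chi (interval i) x ^ (m + 1)) := by rw [mul_pow]; ring

theorem lintegral_dilate_zero_le (i : ℤ × ℤ) (M : ℕ) (h : ℝ → ℝ≥0∞) :
    ∫⁻ x in dilate 0 (interval i), h x ≤
      2 ^ M * (tailAvg M (interval i) h * volume (interval i)) := by
  have e : tailAvg M (interval i) h * volume (interval i) =
      ∫⁻ x, h x * ENNReal.ofReal (chi (interval i) x ^ M) := by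
    rw [tailAvg, mul_comm, ← mul_assoc, ENNReal.mul_inv_cancel (volume_interval_ne_zero i)
      (volume_interval_ne_top i), one_mul]
  rw [e, ← lintegral_const_mul' _ _ (by finiteness)]
  refine le_trans (setLIntegral_mono' (measurableSet_dilate 0 _) fun x hx => ?_)
    (setLIntegral_le_lintegral (dilate 0 (interval i)) _)
  have hv0 : 0 < volume.real (interval i) := by rw [volumeReal_interval]; positivity
  have hx' : Metric.infDist x (interval i) ≤ volume.real (interval i) := by
    have : Metric.infDist x (interval i) ≤ 2 ^ 0 * volume.real (interval i) := hx
    simpa using this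
  have hc : 1 ≤ 2 * chi (interval i) x := by
    have h1 := (div_le_one hv0).2 hx'
    have h0 : 0 ≤ Metric.infDist x (interval i) / volume.real (interval i) :=
      div_nonneg Metric.infDist_nonneg hv0.le
    rw [chi, ← div_eq_mul_inv, le_div_iff₀ (by positivity)]
    linarith
  have h3 : (1 : ℝ≥0∞) ≤ 2 ^ M * ENNReal.ofReal (chi (interval i) x ^ M) := by
    have h2 : (2 : ℝ≥0∞) ^ M = ENNReal.ofReal (2 ^ M) := by
      rw [ENNReal.ofReal_pow zero_le_two]; norm_num
    rw [h2, ← ENNReal.ofReal_mul (by positivity), ← mul_pow, ENNReal.one_le_ofReal]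
    exact one_le_pow₀ hc
  calc h x = h x * 1 := (mul_one _).symm
    _ ≤ h x * (2 ^ M * ENNReal.ofReal (chi (interval i) x ^ M)) := by gcongr
    _ = _ := by ring

/-- Localization: mass far from the large interval contributes to a small interval no more than a
multiple of the large tail average. Only mass in `dilate 0` can create a jump. -/
theorem tailAvg_le_add {i j : ℤ × ℤ} (hji : interval j ⊆ interval i) {M : ℕ} (hM : 1 ≤ M)
    {h : ℝ → ℝ≥0∞} (hh : AEMeasurable h volume) :
    tailAvg M (interval j) h ≤
      tailAvg M (interval j) ((dilate 0 (interval i)).indicator h) +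
        2 ^ M * tailAvg M (interval i) h := by
  have hN := measurableSet_dilate 0 (interval i)
  simp only [tailAvg]
  rw [← lintegral_const_mul' _ _ (by simp [volume_interval_ne_zero]),
    ← lintegral_const_mul' _ _ (by simp [volume_interval_ne_zero]),
    ← lintegral_const_mul' _ _ (by simp [volume_interval_ne_zero]),
    ← lintegral_const_mul' _ _ (by finiteness), ← lintegral_add_left']
  · refine lintegral_mono fun x => ?_
    by_cases hx : x ∈ dilate 0 (interval i)
    · simp [hx]
    · simp only [indicator_of_notMem hx, zero_mul, mul_zero, zero_add]
      have := mul_le_mul_right (inv_volume_mul_chi_le hji hM hx) (h x)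
      calc (volume (interval j))⁻¹ * (h x * ENNReal.ofReal (chi (interval j) x ^ M))
          = h x * ((volume (interval j))⁻¹ * ENNReal.ofReal (chi (interval j) x ^ M)) := by ring
        _ ≤ _ := this
        _ = _ := by ring
  · exact ((hh.indicator hN).mul
      ((measurable_chi _).pow_const M).ennreal_ofReal.aemeasurable).const_mul _

/-- The threshold of the stopping intervals. -/
noncomputable def tailThreshold (M : ℕ) : ℝ≥0 := 2 ^ M * (32 * (8 * 2 ^ M) + 1)

/-- A jump of the tail average at `j` forces a large plain average, of `h` restricted near `i`, over
some cell covering a dilate of `j`. The weak type inequality in each of the two grids bounds the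
union of these cells by `1/8` of the interval, and the two grids together give `1/4`. -/
theorem four_mul_volume_tail_le {M : ℕ} (hM : 2 ≤ M) {h : ℝ → ℝ≥0∞} (hh : AEMeasurable h volume)
    (i : ℤ × ℤ) (G : Finset (ℤ × ℤ))
    (hG : ∀ j ∈ G, interval j ⊆ interval i ∧
      tailThreshold M * tailAvg M (interval i) h < tailAvg M (interval j) h) :
    4 * volume (⋃ j ∈ G, cell 0 j) ≤ volume (cell 0 i) := by
  classical
  rcases G.eq_empty_or_nonempty with rfl | ⟨j₀, hj₀⟩
  · simp
  set A := tailAvg M (interval i) h with hA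
  set N := dilate 0 (interval i) with hN
  have hNm : MeasurableSet N := measurableSet_dilate 0 _
  have hK : (tailThreshold M : ℝ≥0∞) = 2 ^ M * (32 * (8 * 2 ^ M) + 1) := by
    simp [tailThreshold]
  have hAt : A ≠ ∞ := by
    intro hAt
    have h1 := (hG j₀ hj₀).2
    have h2 : (tailThreshold M : ℝ≥0∞) ≠ 0 := by rw [hK]; positivity
    rw [hAt, ENNReal.mul_top h2] at h1
    exact not_top_lt h1
  -- If all covering averages were at most `8 · 2^M A`, the near part would be at most `2^M · 32 ·
  -- (8 · 2^M) A` and the far part at most `2^M A`. These add up to exactly `tailThreshold M * A`.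
  have key : ∀ j ∈ G, ∃ k, 8 * 2 ^ M * A <
      avg (cell (shift (coverGrid j k)) (coverIndex j k)) (N.indicator h) := by
    intro j hj
    by_contra! hcon
    have h1 := tailAvg_le_of_avg_le hM j (hh.indicator hNm) hcon
    have h2 := tailAvg_le_add (hG j hj).1 (by omega : 1 ≤ M) hh
    refine absurd (hG j hj).2 (not_lt.2 (h2.trans ((add_le_add_left h1 _).trans ?_)))
    rw [hK]
    refine le_of_eq ?_
    ring
  have hNh : ∀ P : Set ℝ, ∫⁻ x in P, N.indicator h x ≤ 2 ^ M * (A * volume (interval i)) :=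
    fun P => ((setLIntegral_le_lintegral P _).trans_eq (lintegral_indicator hNm h)).trans
      (lintegral_dilate_zero_le i M h)
  have hA0 : A ≠ 0 := by
    intro h0
    obtain ⟨k, hk⟩ := key j₀ hj₀
    have := hNh (cell (shift (coverGrid j₀ k)) (coverIndex j₀ k))
    rw [h0, zero_mul, mul_zero, nonpos_iff_eq_zero] at this
    rw [avg, this, mul_zero] at hk
    exact not_lt_zero hk
  choose! k hk using key
  have hR : ∀ b, 8 * volume (⋃ r ∈ (G.filter fun j => coverGrid j (k j) = b).image
      (fun j => coverIndex j (k j)), cell (shift b) r) ≤ volume (cell 0 i) := by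
    intro b
    set R := (G.filter fun j => coverGrid j (k j) = b).image (fun j => coverIndex j (k j))
    have h1 := (isNested_shift b).weak_type volume (N.indicator h) (s := 8 * 2 ^ M * A) R ?_
    · have h2 := h1.trans (hNh _)
      rw [← volume_interval]
      have hc0 : (2 ^ M * A : ℝ≥0∞) ≠ 0 := mul_ne_zero (by positivity) hA0
      have hct : (2 ^ M * A : ℝ≥0∞) ≠ ∞ := ENNReal.mul_ne_top (by finiteness) hAt
      rw [← ENNReal.mul_le_mul_iff_right hc0 hct]
      calc _ = 8 * 2 ^ M * A * volume (⋃ r ∈ R, cell (shift b) r) := by ring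
        _ ≤ _ := h2
        _ = _ := by ring
    · intro r hr
      obtain ⟨j, hj, rfl⟩ := Finset.mem_image.1 hr
      obtain ⟨hjG, rfl⟩ := Finset.mem_filter.1 hj
      rw [← avg_mul_volume (volume_cell_ne_zero _ _) (volume_cell_ne_top _ _)]
      exact mul_le_mul_left (hk j hjG).le _
  have hsub : ⋃ j ∈ G, cell 0 j ⊆
      (⋃ r ∈ (G.filter fun j => coverGrid j (k j) = true).image
        (fun j => coverIndex j (k j)), cell (shift true) r) ∪
      (⋃ r ∈ (G.filter fun j => coverGrid j (k j) = false).image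
        (fun j => coverIndex j (k j)), cell (shift false) r) := by
    refine iUnion₂_subset fun j hj => ?_
    have h1 : cell 0 j ⊆ cell (shift (coverGrid j (k j))) (coverIndex j (k j)) :=
      (cell_subset_dyadic 0 j).trans ((subset_dilate (k j) _).trans (dilate_subset_cell j (k j)))
    cases hb : coverGrid j (k j)
    · rw [hb] at h1
      refine Subset.trans ?_ subset_union_right
      exact h1.trans (subset_biUnion_of_mem (u := fun r => cell (shift false) r)
        (Finset.mem_coe.2 (Finset.mem_image.2 ⟨j, Finset.mem_filter.2 ⟨hj, hb⟩, rfl⟩)))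
    · rw [hb] at h1
      refine Subset.trans ?_ subset_union_left
      exact h1.trans (subset_biUnion_of_mem (u := fun r => cell (shift true) r)
        (Finset.mem_coe.2 (Finset.mem_image.2 ⟨j, Finset.mem_filter.2 ⟨hj, hb⟩, rfl⟩)))
  have h3 := (measure_mono hsub).trans (measure_union_le (μ := volume) _ _)
  have h4 := add_le_add (hR true) (hR false)
  rw [← mul_add, ← two_mul] at h4
  have h5 := (mul_le_mul_right h3 8).trans h4
  rw [← ENNReal.mul_le_mul_iff_right two_ne_zero ENNReal.ofNat_ne_top, ← mul_assoc]
  norm_num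
  exact h5

end Tail

/-! ### Sparse families from two stopping conditions -/

section Stopping

variable {ι : Type*}

/-- The sets `E i` witness that the members `D i`, `i ∈ S`, of a finite family are
`1/2`-sparse. -/
structure IsSparseFamily (D : ι → Set ℝ) (S : Finset ι) (E : ι → Set ℝ) : Prop where
  measurable : ∀ i ∈ S, MeasurableSet (E i)
  subset : ∀ i ∈ S, E i ⊆ D i
  volume_le : ∀ i ∈ S, volume (D i) ≤ 2 * volume (E i)
  disjoint : (S : Set ι).PairwiseDisjoint E

/-- Each functional may jump on a quarter of `D i`, so the two jump sets together leave at least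
half of it. -/
theorem IsNested.exists_isSparseFamily {D : ι → Set ℝ} (hD : IsNested D)
    (h0 : ∀ i, volume (D i) ≠ 0) (htop : ∀ i, volume (D i) ≠ ∞) (A B c : ι → ℝ≥0∞) (K L : ℝ≥0∞)
    (F : Finset ι)
    (hA : ∀ i, ∀ G : Finset ι, (∀ j ∈ G, D j ⊆ D i ∧ K * A i < A j) →
      4 * volume (⋃ j ∈ G, D j) ≤ volume (D i))
    (hB : ∀ i, ∀ G : Finset ι, (∀ j ∈ G, D j ⊆ D i ∧ K * B i < B j) →
      4 * volume (⋃ j ∈ G, D j) ≤ volume (D i))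
    (hc : ∀ i ∈ F, ∀ G ⊆ F, (∀ j ∈ G, D j ⊆ D i ∧ A j ≤ K * A i ∧ B j ≤ K * B i) →
      ∑ j ∈ G, c j ≤ L * (A i * B i * volume (D i))) :
    ∃ S E, IsSparseFamily D S E ∧ ∑ j ∈ F, c j ≤ L * ∑ i ∈ S, A i * B i * volume (D i) := by
  classical
  have hex := hD.exists_sparse h0 htop A B c K L F ?_ hc
  · obtain ⟨S, -, E, hE, hd, hs⟩ := hex
    exact ⟨S, E, ⟨fun i hi => (hE i hi).1, fun i hi => (hE i hi).2.1, fun i hi => (hE i hi).2.2,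
      hd⟩, hs⟩
  intro i _ G _ hG
  have h1 := hA i (G.filter fun j => K * A i < A j) fun j hj =>
    ⟨(hG j (Finset.mem_filter.1 hj).1).1, (Finset.mem_filter.1 hj).2⟩
  have h2 := hB i (G.filter fun j => K * B i < B j) fun j hj =>
    ⟨(hG j (Finset.mem_filter.1 hj).1).1, (Finset.mem_filter.1 hj).2⟩
  have hsub : ⋃ j ∈ G, D j ⊆ (⋃ j ∈ G.filter fun j => K * A i < A j, D j) ∪
      ⋃ j ∈ G.filter fun j => K * B i < B j, D j := by
    refine iUnion₂_subset fun j hj => ?_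
    rcases (hG j hj).2 with h | h
    · exact (subset_biUnion_of_mem (u := D) (Finset.mem_coe.2
        (Finset.mem_filter.2 ⟨hj, h⟩))).trans subset_union_left
    · exact (subset_biUnion_of_mem (u := D) (Finset.mem_coe.2
        (Finset.mem_filter.2 ⟨hj, h⟩))).trans subset_union_right
  have h3 := (measure_mono hsub).trans (measure_union_le (μ := volume) _ _)
  have h4 := (mul_le_mul_right h3 4).trans ((mul_add _ _ _).le.trans (add_le_add h1 h2))
  rw [← two_mul] at h4
  rw [← ENNReal.mul_le_mul_iff_right two_ne_zero ENNReal.ofNat_ne_top, ← mul_assoc]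
  norm_num
  exact h4

theorem IsNested.four_mul_volume_avg_le {D : ι → Set ℝ} (hD : IsNested D)
    (h0 : ∀ i, volume (D i) ≠ 0) (htop : ∀ i, volume (D i) ≠ ∞) (u : ℝ → ℝ≥0∞) (i : ι)
    (G : Finset ι) (hG : ∀ j ∈ G, D j ⊆ D i ∧ 4 * avg (D i) u < avg (D j) u) :
    4 * volume (⋃ j ∈ G, D j) ≤ volume (D i) := by
  rcases G.eq_empty_or_nonempty with rfl | ⟨j₀, hj₀⟩
  · simp
  set A := avg (D i) u with hA
  have hAt : A ≠ ∞ := by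
    intro hAt
    have h1 := (hG j₀ hj₀).2
    rw [hAt, ENNReal.mul_top four_ne_zero] at h1
    exact not_top_lt h1
  have hint : ∫⁻ x in D i, u x = A * volume (D i) := (avg_mul_volume (h0 i) (htop i) u).symm
  have hA0 : A ≠ 0 := by
    intro hA0
    have h1 := lintegral_mono_set (μ := volume) (f := u) (hG j₀ hj₀).1
    rw [hint, hA0, zero_mul, nonpos_iff_eq_zero] at h1
    have h2 := (hG j₀ hj₀).2
    rw [avg, h1, mul_zero] at h2
    exact not_lt_zero h2
  have h1 := hD.weak_type volume u (s := 4 * A) G fun j hj => by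
    rw [← avg_mul_volume (h0 j) (htop j)]
    exact mul_le_mul_left (hG j hj).2.le _
  have h2 := h1.trans ((lintegral_mono_set (iUnion₂_subset fun j hj => (hG j hj).1)).trans hint.le)
  rw [← ENNReal.mul_le_mul_iff_right hA0 hAt]
  calc _ = 4 * A * volume (⋃ j ∈ G, D j) := by ring
    _ ≤ _ := h2

end Stopping

/-! ### Sparse domination of the model form with tails -/

section Form

variable {𝕜 : Type*} [RCLike 𝕜] {a : ℤ × ℤ → L2 𝕜 → 𝕜}

theorem aemeasurable_enorm_L2 (f : L2 𝕜) : AEMeasurable (fun x => ‖f x‖ₑ) volume :=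
  (Lp.aestronglyMeasurable f).enorm

theorem enorm_modelForm_le {ε : ℤ × ℤ → 𝕜} (hε : ∀ i, ‖ε i‖ ≤ 1) (F : Finset (ℤ × ℤ))
    (f g : L2 𝕜) : ‖modelForm a ε F f g‖ₑ ≤ ∑ i ∈ F, ‖a i f‖ₑ * ‖a i g‖ₑ := by
  refine (enorm_sum_le _ _).trans (Finset.sum_le_sum fun i _ => ?_)
  rw [enorm_mul, enorm_mul]
  have : ‖ε i‖ₑ ≤ 1 := by
    rw [enorm_eq_nnnorm]
    exact_mod_cast hε i
  calc ‖ε i‖ₑ * ‖a i f‖ₑ * ‖a i g‖ₑ ≤ 1 * ‖a i f‖ₑ * ‖a i g‖ₑ := by gcongr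
    _ = _ := by rw [one_mul]

theorem rpow_sum_sq_le_size (F : Finset (ℤ × ℤ)) (i₀ : ℤ × ℤ) (f : L2 𝕜) :
    (∑ j ∈ below F i₀, ‖a j f‖ₑ ^ (2 : ℝ)) ^ (1 / 2 : ℝ) ≤
      size a F i₀ f * volume (interval i₀) ^ (1 / 2 : ℝ) := by
  have h1 : ((volume (interval i₀))⁻¹ * ∑ j ∈ below F i₀, ‖a j f‖ₑ ^ 2) ^ (1 / 2 : ℝ) ≤
      size a F i₀ f :=
    le_iSup₂ (f := fun i (_ : i ∈ belowPlus F i₀) =>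
      ((volume (interval i))⁻¹ * ∑ j ∈ below F i, ‖a j f‖ₑ ^ 2) ^ (1 / 2 : ℝ)) i₀
      (Finset.mem_insert_self _ _)
  refine le_trans ?_ (mul_le_mul_left h1 _)
  rw [← ENNReal.mul_rpow_of_nonneg _ _ (by norm_num), mul_right_comm,
    ENNReal.inv_mul_cancel (volume_interval_ne_zero _) (volume_interval_ne_top _), one_mul]
  simp

/-- Cauchy–Schwarz, followed by the size condition for each function. Only the top interval of the
supremum in `size` is used, and each factor supplies a square root of `|I₀|`. -/
theorem sum_enorm_mul_le {M : ℕ} {C₂ : ℝ≥0} (hS : SizeCondition a M C₂) (F : Finset (ℤ × ℤ))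
    (i₀ : ℤ × ℤ) (f g : L2 𝕜) :
    ∑ i ∈ below F i₀, ‖a i f‖ₑ * ‖a i g‖ₑ ≤
      C₂ ^ 2 * (sizeTilde M F i₀ f * sizeTilde M F i₀ g * volume (interval i₀)) := by
  refine (ENNReal.inner_le_Lp_mul_Lq _ _ _ Real.HolderConjugate.two_two).trans ?_
  refine (mul_le_mul' ((rpow_sum_sq_le_size F i₀ f).trans (mul_le_mul_left (hS f F i₀) _))
    ((rpow_sum_sq_le_size F i₀ g).trans (mul_le_mul_left (hS g F i₀) _))).trans (le_of_eq ?_)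
  have : volume (interval i₀) = volume (interval i₀) ^ (1 / 2 : ℝ) *
      volume (interval i₀) ^ (1 / 2 : ℝ) := by
    rw [← ENNReal.rpow_add_of_nonneg _ _ (by norm_num) (by norm_num)]; norm_num
  nth_rw 3 [this]
  ring

theorem one_le_tailThreshold (M : ℕ) : (1 : ℝ≥0∞) ≤ tailThreshold M := by
  have h : (1 : ℝ≥0) ≤ tailThreshold M := by
    have h2 : (1 : ℝ≥0) ≤ 2 ^ M := one_le_pow₀ one_le_two
    exact one_le_mul h2 (le_add_of_nonneg_left zero_le)
  exact_mod_cast h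

theorem exists_sparse_tailAvg {M : ℕ} (hM : 3 ≤ M) {C₂ : ℝ≥0} (hS : SizeCondition a M C₂)
    (F : Finset (ℤ × ℤ)) (f g : L2 𝕜) :
    ∃ S E, IsSparseFamily (cell 0) S E ∧
      ∑ i ∈ F, ‖a i f‖ₑ * ‖a i g‖ₑ ≤ (C₂ ^ 2 * tailThreshold M ^ 2 : ℝ≥0) *
        ∑ i ∈ S, tailAvg M (interval i) (fun x => ‖f x‖ₑ) *
          tailAvg M (interval i) (fun x => ‖g x‖ₑ) * volume (cell 0 i) := by
  classical
  refine (isNested_shift false).exists_isSparseFamily (volume_cell_ne_zero 0)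
    (volume_cell_ne_top 0) _ _ _ (tailThreshold M) _ F ?_ ?_ ?_
  · intro i G hG
    exact four_mul_volume_tail_le (by omega) (aemeasurable_enorm_L2 f) i G fun j hj =>
      ⟨cell_subset_iff.1 (hG j hj).1, (hG j hj).2⟩
  · intro i G hG
    exact four_mul_volume_tail_le (by omega) (aemeasurable_enorm_L2 g) i G fun j hj =>
      ⟨cell_subset_iff.1 (hG j hj).1, (hG j hj).2⟩
  · intro i _ G _ hG
    -- The size condition is applied to the unstopped subcollection `G`, not to `F`: over `G` the
    -- tail averages do not exceed the threshold times the one at `i`. The top interval, always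
    -- counted in `belowPlus`, is covered since the threshold is at least one.
    have hb : below G i = G :=
      Finset.filter_true_of_mem fun j hj => cell_subset_iff.1 (hG j hj).1
    have hle : ∀ u : L2 𝕜, (∀ j ∈ G, tailAvg M (interval j) (fun x => ‖u x‖ₑ) ≤
        tailThreshold M * tailAvg M (interval i) (fun x => ‖u x‖ₑ)) →
        sizeTilde M G i u ≤ tailThreshold M * tailAvg M (interval i) (fun x => ‖u x‖ₑ) := by
      intro u hu
      refine iSup₂_le fun j hj => ?_
      rw [locAvg_eq_tailAvg]
      rcases Finset.mem_insert.1 hj with rfl | hj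
      · exact le_mul_of_one_le_left' (one_le_tailThreshold M)
      · exact hu j (hb ▸ hj)
    have h1 := sum_enorm_mul_le hS G i f g
    rw [hb] at h1
    refine h1.trans ?_
    rw [volume_interval, show shift false = 0 by simp [shift]]
    calc _ ≤ (C₂ : ℝ≥0∞) ^ 2 * (tailThreshold M * tailAvg M (interval i) (fun x => ‖f x‖ₑ) *
          (tailThreshold M * tailAvg M (interval i) (fun x => ‖g x‖ₑ)) * volume (cell 0 i)) := by
          gcongr
          · exact hle f fun j hj => (hG j hj).2.1
          · exact hle g fun j hj => (hG j hj).2.2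
      _ = _ := by push_cast; ring

end Form

/-! ### From tail averages to plain averages -/

section Untail

/-- The factor `2` leaves room for a finite partial sum to replace the series, so that all later
stopping arguments run on finite collections. -/
theorem exists_finset_le_two_mul {ι : Type*} {X C : ℝ≥0∞} (hX : X ≠ ∞) {t : ι → ℝ≥0∞}
    (h : X ≤ C * ∑' i, t i) : ∃ s : Finset ι, X ≤ 2 * C * ∑ i ∈ s, t i := by
  by_contra! hcon
  have h1 : 2 * C * ∑' i, t i ≤ X := by
    rw [ENNReal.tsum_eq_iSup_sum, ENNReal.mul_iSup]
    exact iSup_le fun s => (hcon s).le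
  have h2 : X + X ≤ 0 + X := by
    rw [zero_add, ← two_mul]
    exact (mul_le_mul_right h 2).trans ((mul_assoc _ _ _).symm.le.trans h1)
  have h3 := nonpos_iff_eq_zero.1 (ENNReal.le_of_add_le_add_right hX h2)
  exact absurd (hcon ∅) (by simp [h3])

/-- By monotonicity `F k * G l` is at most the diagonal term at `max k l`. Thus both functions can
be averaged over the same covering cell. -/
theorem tsum_mul_tsum_le {w F G : ℕ → ℝ≥0∞} (hF : Monotone F) (hG : Monotone G) :
    (∑' k, w k * F k) * ∑' l, w l * G l ≤ 2 * ((∑' k, w k) * ∑' k, w k * (F k * G k)) := by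
  have key : ∀ k l, F k * G l ≤ F k * G k + F l * G l := by
    intro k l
    rcases le_total k l with h | h
    · exact (mul_le_mul_left (hF h) _).trans le_add_self
    · exact (mul_le_mul_right (hG h) _).trans le_self_add
  calc (∑' k, w k * F k) * ∑' l, w l * G l
      = ∑' k, ∑' l, w k * w l * (F k * G l) := by
        rw [← ENNReal.tsum_mul_right]
        refine tsum_congr fun k => ?_
        rw [← ENNReal.tsum_mul_left]
        exact tsum_congr fun l => by ring
    _ ≤ ∑' k, ∑' l, (w l * (w k * (F k * G k)) + w k * (w l * (F l * G l))) := by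
        refine ENNReal.tsum_le_tsum fun k => ENNReal.tsum_le_tsum fun l => ?_
        refine (mul_le_mul_right (key k l) _).trans (le_of_eq ?_)
        ring
    _ = 2 * ((∑' k, w k) * ∑' k, w k * (F k * G k)) := by
        simp_rw [ENNReal.tsum_add, ENNReal.tsum_mul_left, ENNReal.tsum_mul_right]
        rw [ENNReal.tsum_mul_left]
        ring

/-- On the diagonal each function costs `16 · 2^k` for its covering cell, and `2^(-Mk) 4^k ≤ 2^(-k)`
since `M ≥ 3`. The constant is `1024 = 16² · 2 · 2`, the last two factors coming from the diagonal
reduction and from the sum of the weights. -/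
theorem tailAvg_mul_tailAvg_le {M : ℕ} (hM : 3 ≤ M) (i : ℤ × ℤ) {u v : ℝ → ℝ≥0∞}
    (hu : AEMeasurable u volume) (hv : AEMeasurable v volume) :
    tailAvg M (interval i) u * tailAvg M (interval i) v ≤
      (1024 * 4 ^ M : ℝ≥0) * ∑' k, (2⁻¹ : ℝ≥0∞) ^ k *
        (avg (cell (shift (coverGrid i k)) (coverIndex i k)) u *
          avg (cell (shift (coverGrid i k)) (coverIndex i k)) v) := by
  have hI : 0 < volume.real (interval i) := by rw [volumeReal_interval]; positivity
  set V := volume (interval i)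
  set w : ℕ → ℝ≥0∞ := fun k => ((2⁻¹ : ℝ≥0∞) ^ M) ^ k with hw
  set F : ℕ → ℝ≥0∞ := fun k => V⁻¹ * ∫⁻ x in dilate k (interval i), u x with hF
  set G : ℕ → ℝ≥0∞ := fun k => V⁻¹ * ∫⁻ x in dilate k (interval i), v x with hG
  have hFm : Monotone F := fun k l h =>
    mul_le_mul_right (lintegral_mono_set (dilate_mono _ h)) _
  have hGm : Monotone G := fun k l h =>
    mul_le_mul_right (lintegral_mono_set (dilate_mono _ h)) _
  have h1 : tailAvg M (interval i) u ≤ 2 ^ M * ∑' k, w k * F k := by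
    refine (tailAvg_le_tsum hI M hu).trans (le_of_eq ?_)
    rw [← ENNReal.tsum_mul_left]
    congr 1
    exact tsum_congr fun k => by simp only [hw, hF]; ring
  have h2 : tailAvg M (interval i) v ≤ 2 ^ M * ∑' k, w k * G k := by
    refine (tailAvg_le_tsum hI M hv).trans (le_of_eq ?_)
    rw [← ENNReal.tsum_mul_left]
    congr 1
    exact tsum_congr fun k => by simp only [hw, hG]; ring
  have h4 : (2⁻¹ : ℝ≥0∞) ^ M * 4 ≤ 2⁻¹ := by
    calc (2⁻¹ : ℝ≥0∞) ^ M * 4 ≤ (2⁻¹ : ℝ≥0∞) ^ 3 * 4 := by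
          refine mul_le_mul_left (pow_le_pow_right_of_le_one' ?_ hM) _
          exact ENNReal.inv_le_one.2 one_le_two
      _ = 2⁻¹ * (2⁻¹ * 2) * (2⁻¹ * 2) := by ring
      _ = 2⁻¹ := by
          rw [ENNReal.inv_mul_cancel two_ne_zero ENNReal.ofNat_ne_top, mul_one, mul_one]
  have hw1 : ∀ k, w k ≤ (2⁻¹ : ℝ≥0∞) ^ k := fun k => by
    refine pow_le_pow_left₀ zero_le ?_ k
    exact (le_mul_of_one_le_right' (by norm_num)).trans h4
  have hw2 : ∑' k, w k ≤ 2 := by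
    refine (ENNReal.tsum_le_tsum hw1).trans (le_of_eq ?_)
    rw [ENNReal.tsum_geometric, ENNReal.one_sub_inv_two, inv_inv]
  set U : ℕ → ℝ≥0∞ := fun k => avg (cell (shift (coverGrid i k)) (coverIndex i k)) u
  set W : ℕ → ℝ≥0∞ := fun k => avg (cell (shift (coverGrid i k)) (coverIndex i k)) v
  have h5 : ∀ k, w k * (F k * G k) ≤ 256 * ((2⁻¹ : ℝ≥0∞) ^ k * (U k * W k)) := by
    intro k
    calc w k * (F k * G k) ≤ w k * ((16 * 2 ^ k * U k) * (16 * 2 ^ k * W k)) := by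
          gcongr
          · exact inv_volume_mul_lintegral_dilate_le i k u
          · exact inv_volume_mul_lintegral_dilate_le i k v
      _ = 256 * (((2⁻¹ : ℝ≥0∞) ^ M * 4) ^ k * (U k * W k)) := by
          have : (4 : ℝ≥0∞) ^ k = 2 ^ k * 2 ^ k := by rw [← mul_pow]; norm_num
          rw [mul_pow, this]
          simp only [hw]
          ring
      _ ≤ _ := by gcongr
  calc tailAvg M (interval i) u * tailAvg M (interval i) v
      ≤ (2 ^ M * ∑' k, w k * F k) * (2 ^ M * ∑' k, w k * G k) := mul_le_mul' h1 h2
    _ = 4 ^ M * ((∑' k, w k * F k) * ∑' k, w k * G k) := by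
        have : (4 : ℝ≥0∞) ^ M = 2 ^ M * 2 ^ M := by rw [← mul_pow]; norm_num
        rw [this]; ring
    _ ≤ 4 ^ M * (2 * (2 * ∑' k, 256 * ((2⁻¹ : ℝ≥0∞) ^ k * (U k * W k)))) := by
        refine mul_le_mul_right ((tsum_mul_tsum_le hFm hGm).trans ?_) _
        refine mul_le_mul_right (mul_le_mul' hw2 (ENNReal.tsum_le_tsum h5)) _
    _ = _ := by
        rw [ENNReal.tsum_mul_left]
        push_cast
        ring

theorem sum_volume_le_of_isSparseFamily {ι : Type*} {D : ι → Set ℝ} {S : Finset ι} {E : ι → Set ℝ}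
    (hE : IsSparseFamily D S E) (P : Set ℝ) (T : Finset ι) (hT : T ⊆ S) (hP : ∀ i ∈ T, D i ⊆ P) :
    ∑ i ∈ T, volume (D i) ≤ 2 * volume P := by
  calc ∑ i ∈ T, volume (D i) ≤ ∑ i ∈ T, 2 * volume (E i) :=
        Finset.sum_le_sum fun i hi => hE.volume_le i (hT hi)
    _ = 2 * volume (⋃ i ∈ T, E i) := by
        rw [measure_biUnion_finset (hE.disjoint.subset (Finset.coe_subset.2 hT))
          fun i hi => hE.measurable i (hT hi), Finset.mul_sum]
    _ ≤ _ := by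
        gcongr
        exact iUnion₂_subset fun i hi => (hE.subset i (hT hi)).trans (hP i hi)

/-- The number `X` is dominated by a finite sparse sum over one of the two grids. -/
def SparseBound (C : ℝ≥0∞) (X : ℝ≥0∞) (u v : ℝ → ℝ≥0∞) : Prop :=
  ∃ b S E, IsSparseFamily (cell (shift b)) S E ∧
    X ≤ C * ∑ i ∈ S, avg (cell (shift b) i) u * avg (cell (shift b) i) v *
      volume (cell (shift b) i)

/-- Many pairs `(I, k)` may share a covering cell, so sparseness is lost at first. What survives is
a Carleson packing condition for the weights `w`, and this suffices for a second stopping time, now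
on plain averages. -/
theorem sparseBound_of_cover (u v : ℝ → ℝ≥0∞) {S : Finset (ℤ × ℤ)} {E : ℤ × ℤ → Set ℝ}
    (hE : IsSparseFamily (cell 0) S E) (N : Finset ℕ) (b : Bool) :
    ∃ S' E', IsSparseFamily (cell (shift b)) S' E' ∧
      ∑ p ∈ (S ×ˢ N).filter (fun p => coverGrid p.1 p.2 = b),
        (2⁻¹ : ℝ≥0∞) ^ p.2 * (avg (cell (shift b) (coverIndex p.1 p.2)) u *
          avg (cell (shift b) (coverIndex p.1 p.2)) v) * volume (cell 0 p.1) ≤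
      64 * ∑ i ∈ S', avg (cell (shift b) i) u * avg (cell (shift b) i) v *
        volume (cell (shift b) i) := by
  classical
  set P := (S ×ˢ N).filter (fun p => coverGrid p.1 p.2 = b) with hP
  set D := cell (shift b) with hD
  set r : (ℤ × ℤ) × ℕ → ℤ × ℤ := fun p => coverIndex p.1 p.2 with hr
  set w : (ℤ × ℤ) → ℝ≥0∞ := fun R => ∑ p ∈ P.filter (fun p => r p = R),
    (2⁻¹ : ℝ≥0∞) ^ p.2 * volume (cell 0 p.1) with hw
  have hN := isNested_shift b
  have hex := hN.exists_isSparseFamily (volume_cell_ne_zero _)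
    (volume_cell_ne_top _) (fun i => avg (D i) u) (fun i => avg (D i) v)
    (fun R => avg (D R) u * avg (D R) v * w R) 4 64 (P.image r)
    (hN.four_mul_volume_avg_le (volume_cell_ne_zero _) (volume_cell_ne_top _) u)
    (hN.four_mul_volume_avg_le (volume_cell_ne_zero _) (volume_cell_ne_top _) v) ?_
  · obtain ⟨S', E', hS', hsum⟩ := hex
    refine ⟨S', E', hS', le_trans (le_of_eq ?_) hsum⟩
    rw [← Finset.sum_fiberwise_of_maps_to (g := r) (t := P.image r)
      fun p hp => Finset.mem_image_of_mem _ hp]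
    refine Finset.sum_congr rfl fun R _ => ?_
    rw [hw, Finset.mul_sum]
    refine Finset.sum_congr rfl fun p hp => ?_
    rw [← (Finset.mem_filter.1 hp).2]
    simp only [hr]
    ring
  · intro i _ G _ hG
    -- A cell `R ⊆ D i` contains the intervals it covers. For each `k` sparseness bounds their total
    -- length by `2 |D i|`, and the geometric weights sum to `2`. With the two factors `4` of the
    -- stopping condition this gives `64`.
    have hcarl : ∑ R ∈ G, w R ≤ 4 * volume (D i) := by
      have e1 : ∑ R ∈ G, w R = ∑ p ∈ P.filter (fun p => r p ∈ G),
          (2⁻¹ : ℝ≥0∞) ^ p.2 * volume (cell 0 p.1) := by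
        rw [← Finset.sum_fiberwise_of_maps_to (g := r) (t := G)
          (s := P.filter (fun p => r p ∈ G)) fun p hp => (Finset.mem_filter.1 hp).2]
        refine Finset.sum_congr rfl fun R hR => ?_
        rw [hw, Finset.filter_filter]
        refine Finset.sum_congr ?_ fun _ _ => rfl
        ext p
        simp only [Finset.mem_filter]
        constructor
        · rintro ⟨h1, h2⟩; exact ⟨h1, h2 ▸ hR, h2⟩
        · rintro ⟨h1, _, h2⟩; exact ⟨h1, h2⟩
      have e2 : ∑ p ∈ P.filter (fun p => r p ∈ G), (2⁻¹ : ℝ≥0∞) ^ p.2 * volume (cell 0 p.1) ≤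
          ∑ p ∈ (S.filter fun j => cell 0 j ⊆ D i) ×ˢ N,
            (2⁻¹ : ℝ≥0∞) ^ p.2 * volume (cell 0 p.1) := by
        refine Finset.sum_le_sum_of_subset fun p hp => ?_
        obtain ⟨hp, hpG⟩ := Finset.mem_filter.1 hp
        obtain ⟨hp, hpb⟩ := Finset.mem_filter.1 hp
        obtain ⟨hp1, hp2⟩ := Finset.mem_product.1 hp
        refine Finset.mem_product.2 ⟨Finset.mem_filter.2 ⟨hp1, ?_⟩, hp2⟩
        refine ((cell_subset_dyadic 0 p.1).trans ((subset_dilate p.2 _).trans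
          (dilate_subset_cell p.1 p.2))).trans ?_
        rw [hpb]
        exact (hG _ hpG).1
      rw [e1]
      refine e2.trans ?_
      rw [Finset.sum_product_right]
      calc ∑ k ∈ N, ∑ j ∈ S.filter (fun j => cell 0 j ⊆ D i),
            (2⁻¹ : ℝ≥0∞) ^ k * volume (cell 0 j)
          ≤ ∑ k ∈ N, (2⁻¹ : ℝ≥0∞) ^ k * (2 * volume (D i)) := by
            refine Finset.sum_le_sum fun k _ => ?_
            rw [← Finset.mul_sum]
            refine mul_le_mul_right ?_ _
            exact sum_volume_le_of_isSparseFamily hE _ _ (Finset.filter_subset _ _)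
              fun j hj => (Finset.mem_filter.1 hj).2
        _ ≤ (∑' k : ℕ, (2⁻¹ : ℝ≥0∞) ^ k) * (2 * volume (D i)) := by
            rw [← Finset.sum_mul]
            exact mul_le_mul_left (ENNReal.sum_le_tsum _) _
        _ = 4 * volume (D i) := by
            rw [ENNReal.tsum_geometric, ENNReal.one_sub_inv_two, inv_inv, ← mul_assoc]
            norm_num
    calc ∑ R ∈ G, avg (D R) u * avg (D R) v * w R
        ≤ ∑ R ∈ G, (4 * avg (D i) u) * (4 * avg (D i) v) * w R :=
          Finset.sum_le_sum fun R hR => mul_le_mul_left (mul_le_mul' (hG R hR).2.1 (hG R hR).2.2) _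
      _ = (4 * avg (D i) u) * (4 * avg (D i) v) * ∑ R ∈ G, w R := by rw [Finset.mul_sum]
      _ ≤ (4 * avg (D i) u) * (4 * avg (D i) v) * (4 * volume (D i)) :=
          mul_le_mul_right hcarl _
      _ = _ := by ring

theorem sparseBound_of_tailAvg {M : ℕ} (hM : 3 ≤ M) {u v : ℝ → ℝ≥0∞}
    (hu : AEMeasurable u volume) (hv : AEMeasurable v volume) {S : Finset (ℤ × ℤ)}
    {E : ℤ × ℤ → Set ℝ} (hE : IsSparseFamily (cell 0) S E) {X : ℝ≥0∞} (hX : X ≠ ∞) {C : ℝ≥0∞}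
    (h : X ≤ C * ∑ i ∈ S, tailAvg M (interval i) u * tailAvg M (interval i) v *
      volume (cell 0 i)) :
    SparseBound (256 * (C * (1024 * 4 ^ M : ℝ≥0))) X u v := by
  classical
  set t : Bool → (ℤ × ℤ) × ℕ → ℝ≥0∞ := fun b p => (2⁻¹ : ℝ≥0∞) ^ p.2 *
    (avg (cell (shift b) (coverIndex p.1 p.2)) u *
      avg (cell (shift b) (coverIndex p.1 p.2)) v) * volume (cell 0 p.1) with ht
  have h1 : X ≤ C * (1024 * 4 ^ M : ℝ≥0) *
      ∑' k : ℕ, ∑ i ∈ S, t (coverGrid i k) (i, k) := by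
    rw [Summable.tsum_finsetSum fun _ _ => ENNReal.summable]
    refine h.trans ?_
    rw [mul_assoc]
    refine mul_le_mul_right ?_ _
    rw [Finset.mul_sum]
    refine Finset.sum_le_sum fun i _ => ?_
    refine (mul_le_mul_left (tailAvg_mul_tailAvg_le hM i hu hv) _).trans (le_of_eq ?_)
    simp only [ht]
    rw [ENNReal.tsum_mul_right, mul_assoc]
  obtain ⟨N, hN⟩ := exists_finset_le_two_mul hX h1
  set T : Bool → ℝ≥0∞ := fun b => ∑ p ∈ (S ×ˢ N).filter (fun p => coverGrid p.1 p.2 = b), t b p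
    with hT
  have h2 : ∑ k ∈ N, ∑ i ∈ S, t (coverGrid i k) (i, k) = T true + T false := by
    rw [← Finset.sum_product_right' S N fun i k => t (coverGrid i k) (i, k),
      ← Finset.sum_filter_add_sum_filter_not _ fun p => coverGrid p.1 p.2 = true]
    congr 1
    · exact Finset.sum_congr rfl fun p hp => by rw [(Finset.mem_filter.1 hp).2]
    · simp only [Bool.not_eq_true]
      exact Finset.sum_congr rfl fun p hp => by rw [(Finset.mem_filter.1 hp).2]
  -- Keeping only the grid with the larger contribution places the family in one nested grid. The
  -- constant `256` is `2` for truncation, `2` for this choice, and `64`.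
  have h3 : ∃ b, T true + T false ≤ 2 * T b := by
    rcases le_total (T true) (T false) with h | h
    · exact ⟨false, by rw [two_mul]; gcongr⟩
    · exact ⟨true, by rw [two_mul]; gcongr⟩
  obtain ⟨b, hb⟩ := h3
  obtain ⟨S', E', hS', hs⟩ := sparseBound_of_cover u v hE N b
  refine ⟨b, S', E', hS', hN.trans ?_⟩
  rw [h2]
  refine (mul_le_mul_right (hb.trans (mul_le_mul_right hs 2)) _).trans (le_of_eq ?_)
  ring

variable {𝕜 : Type*} [RCLike 𝕜] {a : ℤ × ℤ → L2 𝕜 → 𝕜}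

/-- The constant of the sparse domination of the operator. -/
noncomputable def sparseConst (M : ℕ) (C₀ C₂ : ℝ≥0) : ℝ≥0 :=
  256 * (2 * C₀ * (C₂ ^ 2 * tailThreshold M ^ 2) * (1024 * 4 ^ M))

theorem sparseBound_inner {T : L2 𝕜 →L[𝕜] L2 𝕜} {M : ℕ} (hM : 3 ≤ M) {C₀ C₂ : ℝ≥0}
    (hT : FormBound T a C₀) (hS : SizeCondition a M C₂) (f g : L2 𝕜) :
    SparseBound (sparseConst M C₀ C₂) ‖inner 𝕜 (T f) g‖ₑ (fun x => ‖f x‖ₑ) fun x => ‖g x‖ₑ := by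
  have hX : ‖inner 𝕜 (T f) g‖ₑ ≠ ∞ := enorm_ne_top
  obtain ⟨F, hF⟩ := exists_finset_le_two_mul hX (hT f g)
  obtain ⟨S, E, hE, hs⟩ := exists_sparse_tailAvg hM hS F f g
  have h := sparseBound_of_tailAvg hM (aemeasurable_enorm_L2 f) (aemeasurable_enorm_L2 g) hE hX
    (C := 2 * C₀ * (C₂ ^ 2 * tailThreshold M ^ 2 : ℝ≥0)) (by
      rw [mul_assoc]; exact hF.trans (mul_le_mul_right hs _))
  convert h using 1
  simp [sparseConst]

end Untail

/-! ### Weak type estimate from sparse bounds -/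

section WeakType

variable {𝕜 : Type*} [RCLike 𝕜]

/-- A function of prescribed size that is aligned with a given element of `L²`. -/
theorem exists_dual (h : L2 𝕜) {φ : ℝ → ℝ} (hφ0 : ∀ x, 0 ≤ φ x) (hφ : MemLp φ 2 volume) :
    ∃ g : L2 𝕜, (∀ᵐ x, ‖g x‖ₑ ≤ ENNReal.ofReal (φ x)) ∧
      ‖inner 𝕜 h g‖ₑ = ∫⁻ x, ‖h x‖ₑ * ENNReal.ofReal (φ x) := by
  -- Where `h` vanishes, the quotient is zero by the convention on division. There `G = 0`, which
  -- affects neither the bound nor the pairing.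
  set G : ℝ → 𝕜 := fun x => ((φ x / ‖h x‖ : ℝ) : 𝕜) * h x with hG
  have hhm : AEStronglyMeasurable h volume := Lp.aestronglyMeasurable h
  have hGm : AEStronglyMeasurable G volume := by
    refine AEStronglyMeasurable.mul ?_ hhm
    exact (RCLike.measurable_ofReal.comp_aemeasurable
      (hφ.1.aemeasurable.div hhm.norm.aemeasurable)).aestronglyMeasurable
  have hle : ∀ x, ‖G x‖ ≤ φ x := by
    intro x
    rw [hG]
    simp only [norm_mul, RCLike.norm_ofReal, abs_of_nonneg (div_nonneg (hφ0 x) (norm_nonneg _))]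
    rcases eq_or_ne ‖h x‖ 0 with h0 | h0
    · rw [h0, mul_zero]; exact hφ0 x
    · rw [div_mul_cancel₀ _ h0]
  have hGL : MemLp G 2 volume := hφ.of_le hGm (Filter.Eventually.of_forall fun x => by
    rw [Real.norm_of_nonneg (hφ0 x)]; exact hle x)
  refine ⟨hGL.toLp G, ?_, ?_⟩
  · filter_upwards [hGL.coeFn_toLp] with x hx
    rw [hx, ← ofReal_norm]
    exact ENNReal.ofReal_le_ofReal (hle x)
  · have hint : Integrable (fun x => ‖h x‖ * φ x) volume := by
      have := (Lp.memLp h).norm.integrable_mul hφ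
      exact this
    have e : inner 𝕜 h (hGL.toLp G) = ((∫ x, ‖h x‖ * φ x : ℝ) : 𝕜) := by
      rw [L2.inner_def, ← integral_ofReal]
      refine integral_congr_ae ?_
      filter_upwards [hGL.coeFn_toLp] with x hx
      rw [hx, hG]
      simp only [RCLike.inner_apply]
      rw [mul_assoc, RCLike.mul_conj]
      rcases eq_or_ne (‖h x‖) 0 with h0 | h0
      · simp [h0]
      · rw [← RCLike.ofReal_pow, ← RCLike.ofReal_mul]
        congr 1
        field_simp
    have h0 : 0 ≤ ∫ x, ‖h x‖ * φ x :=
      integral_nonneg fun x => mul_nonneg (norm_nonneg _) (hφ0 x)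
    rw [e, ← ofReal_norm, RCLike.norm_ofReal, abs_of_nonneg h0,
      ofReal_integral_eq_lintegral_ofReal hint
        (Filter.Eventually.of_forall fun x => mul_nonneg (norm_nonneg _) (hφ0 x))]
    refine lintegral_congr fun x => ?_
    rw [ENNReal.ofReal_mul (norm_nonneg _), ofReal_norm]

theorem IsNested.weak_type_countable {ι : Type*} [Countable ι] {D : ι → Set ℝ} (hD : IsNested D)
    (μ : Measure ℝ) (h : ℝ → ℝ≥0∞) {s : ℝ≥0∞} (P : Set ι)
    (hP : ∀ j ∈ P, s * μ (D j) ≤ ∫⁻ x in D j, h x ∂μ) :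
    s * μ (⋃ j ∈ P, D j) ≤ ∫⁻ x, h x ∂μ := by
  classical
  rw [biUnion_eq_iUnion, iUnion_eq_iUnion_finset, Directed.measure_iUnion, ENNReal.mul_iSup]
  · refine iSup_le fun G => ?_
    have := hD.weak_type μ h (s := s) (G.image Subtype.val) fun j hj => by
      obtain ⟨j, _, rfl⟩ := Finset.mem_image.1 hj
      exact hP j j.2
    rw [Finset.set_biUnion_finset_image] at this
    exact this.trans (setLIntegral_le_lintegral _ _)
  · exact Monotone.directed_le fun s t hst => biUnion_subset_biUnion_left hst

theorem SparseBound.symm {C X : ℝ≥0∞} {u v : ℝ → ℝ≥0∞} (h : SparseBound C X u v) :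
    SparseBound C X v u := by
  obtain ⟨b, S, E, hE, hX⟩ := h
  refine ⟨b, S, E, hE, hX.trans (le_of_eq ?_)⟩
  congr 1
  exact Finset.sum_congr rfl fun i _ => by rw [mul_comm (avg _ u)]

theorem sum_mul_mul_le_sqrt {ι : Type*} (S : Finset ι) (x y w : ι → ℝ≥0∞) :
    ∑ i ∈ S, x i * y i * w i ≤ (∑ i ∈ S, x i ^ (2 : ℝ) * w i) ^ (1 / 2 : ℝ) *
      (∑ i ∈ S, y i ^ (2 : ℝ) * w i) ^ (1 / 2 : ℝ) := by
  have h := ENNReal.inner_le_Lp_mul_Lq S (fun i => x i * w i ^ (1 / 2 : ℝ))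
    (fun i => y i * w i ^ (1 / 2 : ℝ)) Real.HolderConjugate.two_two
  have e : ∀ z : ℝ≥0∞, z ^ (1 / 2 : ℝ) * z ^ (1 / 2 : ℝ) = z := fun z => by
    rw [← ENNReal.rpow_add_of_nonneg _ _ (by norm_num) (by norm_num)]; norm_num
  have e2 : ∀ z w : ℝ≥0∞, (z * w ^ (1 / 2 : ℝ)) ^ (2 : ℝ) = z ^ (2 : ℝ) * w := fun z w => by
    rw [ENNReal.mul_rpow_of_nonneg _ _ zero_le_two, ← ENNReal.rpow_mul]; norm_num
  simp only [e2] at h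
  refine le_trans (le_of_eq (Finset.sum_congr rfl fun i _ => ?_)) h
  rw [mul_mul_mul_comm, e]

/-- Lengths are moved to the disjoint sets `E i` at the cost of `2`. Cauchy–Schwarz then separates
the two functions, and bounded averages allow the `L²` bound with `L¹` data. -/
theorem sum_avg_mul_avg_le {D : ℤ × ℤ → Set ℝ} (hD : IsNested D)
    (h0 : ∀ i, volume (D i) ≠ 0) (ht : ∀ i, volume (D i) ≠ ∞) {S : Finset (ℤ × ℤ)}
    {E : ℤ × ℤ → Set ℝ} (hE : IsSparseFamily D S E) {u v : ℝ → ℝ≥0∞}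
    (hu : AEMeasurable u volume) (hv : AEMeasurable v volume) {l : ℝ≥0} {m : ℝ≥0}
    (hl : ∀ i ∈ S, avg (D i) u ≤ l) (hm : ∀ i ∈ S, avg (D i) v ≤ m) :
    ∑ i ∈ S, avg (D i) u * avg (D i) v * volume (D i) ≤
      4 * ((l * ∫⁻ x, u x) * (m * ∫⁻ x, v x)) ^ (1 / 2 : ℝ) := by
  have hsq : ∀ {w : ℝ → ℝ≥0∞} (_ : AEMeasurable w volume) {n : ℝ≥0}
      (_ : ∀ i ∈ S, avg (D i) w ≤ n),
      ∑ i ∈ S, avg (D i) w ^ (2 : ℝ) * volume (E i) ≤ 2 * (n * ∫⁻ x, w x) := by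
    intro w hw n hn
    have e : ∀ i ∈ S, ((avg (D i) w).toNNReal : ℝ≥0∞) = avg (D i) w := fun i hi =>
      ENNReal.coe_toNNReal (ne_top_of_le_ne_top ENNReal.coe_ne_top (hn i hi))
    have := sum_sq_le_of_le hD volume S (fun i => (avg (D i) w).toNNReal) hw
      (fun i hi => by rw [e i hi, avg_mul_volume (h0 i) (ht i)])
      (fun i hi => ⟨hE.measurable i hi, hE.subset i hi⟩) hE.disjoint (l := n)
      (fun i hi => by rw [← ENNReal.coe_le_coe, e i hi]; exact hn i hi)
    refine le_trans (le_of_eq (Finset.sum_congr rfl fun i hi => ?_)) this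
    rw [e i hi]
  calc ∑ i ∈ S, avg (D i) u * avg (D i) v * volume (D i)
      ≤ ∑ i ∈ S, avg (D i) u * avg (D i) v * (2 * volume (E i)) :=
        Finset.sum_le_sum fun i hi => mul_le_mul_right (hE.volume_le i hi) _
    _ = 2 * ∑ i ∈ S, avg (D i) u * avg (D i) v * volume (E i) := by
        rw [Finset.mul_sum]
        exact Finset.sum_congr rfl fun i _ => by ring
    _ ≤ 2 * ((2 * (l * ∫⁻ x, u x)) ^ (1 / 2 : ℝ) * (2 * (m * ∫⁻ x, v x)) ^ (1 / 2 : ℝ)) := by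
        refine mul_le_mul_right ((sum_mul_mul_le_sqrt S _ _ _).trans (mul_le_mul' ?_ ?_)) _
        · exact ENNReal.rpow_le_rpow (hsq hu hl) (by norm_num)
        · exact ENNReal.rpow_le_rpow (hsq hv hm) (by norm_num)
    _ = _ := by
        have e2 : (2 : ℝ≥0∞) ^ (1 / 2 : ℝ) * 2 ^ (1 / 2 : ℝ) = 2 := by
          rw [← ENNReal.rpow_add_of_nonneg _ _ (by norm_num) (by norm_num)]; norm_num
        rw [ENNReal.mul_rpow_of_nonneg _ _ (by norm_num : (0 : ℝ) ≤ 1 / 2),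
          ENNReal.mul_rpow_of_nonneg 2 (m * _) (by norm_num : (0 : ℝ) ≤ 1 / 2),
          ENNReal.mul_rpow_of_nonneg (l * _) (m * _) (by norm_num : (0 : ℝ) ≤ 1 / 2)]
        calc _ = 2 * ((2 : ℝ≥0∞) ^ (1 / 2 : ℝ) * 2 ^ (1 / 2 : ℝ)) *
              ((l * ∫⁻ x, u x) ^ (1 / 2 : ℝ) * (m * ∫⁻ x, v x) ^ (1 / 2 : ℝ)) := by ring
          _ = _ := by rw [e2]; norm_num

/-- The exceptional set, where some dyadic average of `|f|` exceeds `l`, is removed from the level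
set, and `T f` is paired with a function of modulus at most one, aligned with it, on the rest. Cells
with a large average of `|f|` lie in the exceptional set and contribute nothing; on the others both
averages are bounded. -/
theorem weakTypeOne_of_sparseBound {T : L2 𝕜 →L[𝕜] L2 𝕜} {C : ℝ≥0}
    (hT : ∀ f g : L2 𝕜, SparseBound C ‖inner 𝕜 (T f) g‖ₑ (fun x => ‖f x‖ₑ) fun x => ‖g x‖ₑ) :
    WeakTypeOne T (32 * C) := by
  intro f hf t ht
  set u : ℝ → ℝ≥0∞ := fun x => ‖f x‖ₑ with hu
  have hum : AEMeasurable u volume := aemeasurable_enorm_L2 f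
  rw [eLpNorm_one_eq_lintegral_enorm]
  set N := ∫⁻ x, u x with hN
  change _ ≤ ((32 * C : ℝ≥0) : ℝ≥0∞) * N
  have hNt : N ≠ ∞ := hf.2.ne
  set G : Set ℝ := {x | (t : ℝ) < ‖T f x‖} with hG
  have hGm : MeasurableSet G :=
    measurableSet_lt measurable_const (Lp.stronglyMeasurable (T f)).norm.measurable
  set V := volume G with hV
  have hVt : V ≠ ∞ := by
    have h1 := mul_meas_ge_le_pow_eLpNorm' volume two_ne_zero ENNReal.ofNat_ne_top
      (Lp.aestronglyMeasurable (T f)) t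
    have h2 : V ≤ volume {x | (t : ℝ≥0∞) ≤ ‖T f x‖ₑ} := by
      refine measure_mono fun x hx => ?_
      have h3 : (t : ℝ) < ‖T f x‖ := hx
      have h4 : t ≤ ‖T f x‖₊ := by exact_mod_cast h3.le
      change (t : ℝ≥0∞) ≤ ‖T f x‖ₑ
      rw [enorm_eq_nnnorm]
      exact_mod_cast h4
    intro hVt
    rw [hVt, top_le_iff] at h2
    rw [h2] at h1
    have h5 : (t : ℝ≥0∞) ^ (2 : ℝ≥0∞).toReal ≠ 0 := by simp [ht.ne']
    rw [ENNReal.mul_top h5, top_le_iff] at h1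
    exact (ENNReal.rpow_ne_top_of_nonneg (by simp) (Lp.eLpNorm_ne_top (T f))) h1
  rcases eq_or_ne V 0 with hV0 | hV0
  · rw [hV0, mul_zero]; exact zero_le
  have hN0 : N ≠ 0 := by
    intro h0
    rw [hN, lintegral_eq_zero_iff' hum] at h0
    have hf0 : f = 0 := by
      rw [Lp.eq_zero_iff_ae_eq_zero]
      filter_upwards [h0] with x hx
      simpa [hu] using hx
    apply hV0
    rw [hV, hG, hf0, map_zero]
    refine measure_mono_null (t := {x | ¬ (0 : L2 𝕜) x = 0}) (fun x hx h0 => ?_)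
      (ae_iff.1 (Lp.coeFn_zero 𝕜 2 volume))
    have h3 : (t : ℝ) < ‖(0 : L2 𝕜) x‖ := hx
    rw [h0, norm_zero] at h3
    exact absurd h3 (not_lt.2 t.2)
  -- With `l = 16 N / V` each exceptional set has measure at most `V / 16`, so at least half of the
  -- level set survives, while `(l N V)^(1/2) = 4 N`. Finiteness of `V` is Chebyshev's inequality in
  -- `L²`.
  have hlt : 16 * N / V ≠ ∞ := ENNReal.div_ne_top (by finiteness) hV0
  set l : ℝ≥0 := (16 * N / V).toNNReal with hl
  have hlc : (l : ℝ≥0∞) = 16 * N / V := ENNReal.coe_toNNReal hlt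
  have hlV : l * V = 16 * N := by rw [hlc, ENNReal.div_mul_cancel hV0 hVt]
  set H : Bool → Set ℝ := fun b => ⋃ i ∈ {i | (l : ℝ≥0∞) < avg (cell (shift b) i) u},
    cell (shift b) i with hH
  have hHm : ∀ b, MeasurableSet (H b) := fun b =>
    MeasurableSet.biUnion (to_countable _) fun i _ => measurableSet_cell _ i
  have hHv : ∀ b, 4 * volume (H b) ≤ V := by
    intro b
    have h1 : l * volume (H b) ≤ N :=
      (isNested_shift b).weak_type_countable volume u _ fun j hj => by
        rw [← avg_mul_volume (volume_cell_ne_zero _ _) (volume_cell_ne_top _ _)]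
        exact mul_le_mul_left (le_of_lt hj) _
    have h2 : (16 * N) * volume (H b) ≤ N * V := by
      rw [← hlV, mul_right_comm]; gcongr
    have h3 : N * (16 * volume (H b)) ≤ N * V := by
      refine le_trans (le_of_eq ?_) h2; ring
    have h4 := (ENNReal.mul_le_mul_iff_right hN0 hNt).1 h3
    refine le_trans ?_ h4
    gcongr
    norm_num
  set G' := G \ (H true ∪ H false) with hG'
  have hG'm : MeasurableSet G' := hGm.diff ((hHm _).union (hHm _))
  have hVG' : V ≤ 2 * volume G' := by
    have h1 : V ≤ volume G' + (volume (H true) + volume (H false)) := by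
      refine (measure_mono (t := G' ∪ (H true ∪ H false)) ?_).trans
        ((measure_union_le _ _).trans ?_)
      · rw [hG', sdiff_union_self]; exact subset_union_left
      · gcongr; exact measure_union_le _ _
    have h2 : 2 * (volume (H true) + volume (H false)) ≤ V := by
      rw [← ENNReal.mul_le_mul_iff_right two_ne_zero ENNReal.ofNat_ne_top, two_mul V]
      refine le_trans (le_of_eq ?_) (add_le_add (hHv true) (hHv false))
      ring
    have h3 : V + V ≤ 2 * volume G' + V := by
      rw [← two_mul]
      refine (mul_le_mul_right h1 2).trans ?_
      rw [mul_add]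
      gcongr
    exact ENNReal.le_of_add_le_add_right hVt h3
  have hG't : volume G' ≠ ∞ := measure_ne_top_of_subset sdiff_subset hVt
  obtain ⟨g, hg, hin⟩ := exists_dual (T f) (φ := G'.indicator fun _ => (1 : ℝ))
    (fun x => indicator_nonneg (fun _ _ => zero_le_one) x)
    (memLp_indicator_const 2 hG'm 1 (Or.inr hG't))
  set v : ℝ → ℝ≥0∞ := fun x => ‖g x‖ₑ with hv
  have hvm : AEMeasurable v volume := aemeasurable_enorm_L2 g
  have hvle : ∀ᵐ x, v x ≤ G'.indicator 1 x := by
    filter_upwards [hg] with x hx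
    refine hx.trans (le_of_eq ?_)
    by_cases hxG : x ∈ G' <;> simp [hxG]
  have hvint : ∀ Q : Set ℝ, MeasurableSet Q → ∫⁻ x in Q, v x ≤ volume (G' ∩ Q) := by
    intro Q hQ
    refine (setLIntegral_mono_ae' hQ (hvle.mono fun x hx _ => hx)).trans ?_
    rw [lintegral_indicator_one hG'm, Measure.restrict_apply hG'm]
  have hlow : t * volume G' ≤ ‖inner 𝕜 (T f) g‖ₑ := by
    rw [hin, ← setLIntegral_const, ← lintegral_indicator hG'm]
    refine lintegral_mono fun x => ?_
    by_cases hxG : x ∈ G'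
    · have h3 : (t : ℝ) < ‖T f x‖ := hxG.1
      have h4 : t ≤ ‖T f x‖₊ := by exact_mod_cast h3.le
      simp only [hxG, indicator_of_mem, ENNReal.ofReal_one, mul_one]
      rw [enorm_eq_nnnorm]
      exact_mod_cast h4
    · simp [hxG]
  obtain ⟨b, S, E, hE, hS⟩ := hT f g
  set D := cell (shift b) with hD
  set S' := S.filter fun i => avg (D i) u ≤ l with hS'
  have hsum : ∑ i ∈ S, avg (D i) u * avg (D i) v * volume (D i) ≤
      ∑ i ∈ S', avg (D i) u * avg (D i) v * volume (D i) := by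
    refine le_of_eq (Finset.sum_filter_of_ne fun i _ hne => ?_).symm
    by_contra hcon
    apply hne
    have hsub : D i ⊆ H b := subset_biUnion_of_mem (u := fun i => cell (shift b) i)
      (show i ∈ {i | (l : ℝ≥0∞) < avg (cell (shift b) i) u} from not_le.1 hcon)
    have hemp : G' ∩ D i = ∅ := by
      rw [← disjoint_iff_inter_eq_empty]
      refine disjoint_sdiff_left.mono_right (hsub.trans ?_)
      cases b
      · exact subset_union_right
      · exact subset_union_left
    have h0 := hvint (D i) (measurableSet_cell _ i)
    rw [hemp, measure_empty, nonpos_iff_eq_zero] at h0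
    have : avg (D i) v = 0 := by rw [avg, h0, mul_zero]
    rw [this, mul_zero, zero_mul]
  have hE' : IsSparseFamily D S' E :=
    ⟨fun i hi => hE.measurable i (Finset.mem_filter.1 hi).1,
      fun i hi => hE.subset i (Finset.mem_filter.1 hi).1,
      fun i hi => hE.volume_le i (Finset.mem_filter.1 hi).1,
      hE.disjoint.subset (Finset.coe_subset.2 (Finset.filter_subset _ _))⟩
  have hmain := sum_avg_mul_avg_le (isNested_shift b) (volume_cell_ne_zero _)
    (volume_cell_ne_top _) hE' hum hvm (l := l) (m := 1)
    (fun i hi => (Finset.mem_filter.1 hi).2) fun i _ => by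
      rw [avg, ← ENNReal.div_eq_inv_mul]
      refine ENNReal.div_le_of_le_mul ?_
      rw [ENNReal.coe_one, one_mul]
      exact (hvint (D i) (measurableSet_cell _ i)).trans (measure_mono inter_subset_right)
  have hvV : ∫⁻ x, v x ≤ V := by
    have := hvint univ MeasurableSet.univ
    rw [setLIntegral_univ, inter_univ] at this
    exact this.trans (measure_mono sdiff_subset)
  have hroot : ((l * ∫⁻ x, u x) * (((1 : ℝ≥0) : ℝ≥0∞) * ∫⁻ x, v x)) ^ (1 / 2 : ℝ) ≤ 4 * N := by
    calc ((l * ∫⁻ x, u x) * (((1 : ℝ≥0) : ℝ≥0∞) * ∫⁻ x, v x)) ^ (1 / 2 : ℝ)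
        ≤ ((4 * N) ^ (2 : ℝ)) ^ (1 / 2 : ℝ) := by
          refine ENNReal.rpow_le_rpow ?_ (by norm_num)
          rw [ENNReal.coe_one, one_mul]
          calc (l * N) * ∫⁻ x, v x ≤ (l * N) * V := by gcongr
            _ = (l * V) * N := by ring
            _ = (4 * N) ^ (2 : ℝ) := by
              rw [hlV, ENNReal.rpow_two]; ring
      _ = 4 * N := by rw [← ENNReal.rpow_mul]; norm_num
  calc t * V ≤ t * (2 * volume G') := by gcongr
    _ = 2 * (t * volume G') := by ring
    _ ≤ 2 * (C * (4 * (4 * N))) := by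
        refine mul_le_mul_right (hlow.trans (hS.trans (mul_le_mul_right ?_ _))) _
        exact hsum.trans (hmain.trans (mul_le_mul_right hroot _))
    _ = ((32 * C : ℝ≥0) : ℝ≥0∞) * N := by push_cast; ring

end WeakType

/-! ### Weighted bounds for sparse forms, `p ≥ 2` -/

section Weighted

theorem holderConjugate_one_sub_inv {p q : ℝ} (h : p.HolderConjugate q) : 1 / q = 1 - 1 / p := by
  rw [one_div, one_div, h.one_sub_inv]

/-- Here `V, W, Z` stand for the length, `ω`-mass and `σ`-mass of a cell, and `e, w, s` for those of
its set `E`. Factoring out the `A_p` product leaves `V (V / Z)^(p-2)`; as `p ≥ 2`, the exponent is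
nonnegative and `V, Z` may be replaced by `2 e, s`. Hölder on `E` then turns `e^(p-1) s^(2-p)` into
the dual powers of `s` and `w`. The dependence on `A` stays linear. -/
theorem weighted_term_le_real {p A W Z V w s e : ℝ} (hp : 2 ≤ p) (hW : 0 < W) (hZ : 0 < Z)
    (hV : 0 < V) (hw : 0 < w) (hs : 0 < s) (he : 0 < e) (hA : W / V * (Z / V) ^ (p - 1) ≤ A)
    (hVe : V ≤ 2 * e) (hsZ : s ≤ Z) (hews : e ≤ w ^ (1 / p) * s ^ (1 - 1 / p)) :
    Z * W / V ≤ 2 ^ (p - 1) * A * (s ^ (1 / p) * w ^ (1 - 1 / p)) := by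
  have hp0 : p ≠ 0 := by positivity
  have hA0 : 0 ≤ A := le_trans (by positivity) hA
  have h1 : Z * W / V = V * (W / V * (Z / V) ^ (p - 1)) * (V / Z) ^ (p - 2) := by
    have e1 : (Z / V) ^ (p - 1) = (Z / V) * (Z / V) ^ (p - 2) := by
      rw [← Real.rpow_one_add' (by positivity) (by linarith)]; congr 1; ring
    have e2 : (Z / V) ^ (p - 2) * (V / Z) ^ (p - 2) = 1 := by
      rw [← Real.mul_rpow (by positivity) (by positivity), div_mul_div_cancel₀ hV.ne',
        div_self hZ.ne', Real.one_rpow]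
    rw [e1]
    calc Z * W / V = V * (W / V * (Z / V)) * 1 := by field_simp
      _ = _ := by rw [← e2]; ring
  have h2 : (V / Z) ^ (p - 2) ≤ (2 * e / s) ^ (p - 2) := by
    refine Real.rpow_le_rpow (by positivity) ?_ (by linarith)
    gcongr
  have h3 : Z * W / V ≤ (2 * e) * A * (2 * e / s) ^ (p - 2) := by
    rw [h1]; gcongr
  have h4 : (2 * e) * A * (2 * e / s) ^ (p - 2) = 2 ^ (p - 1) * A * (e ^ (p - 1) * s ^ (2 - p)) := by
    have e1 : (2 : ℝ) ^ (p - 1) * e ^ (p - 1) = (2 * e) * (2 * e) ^ (p - 2) := by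
      rw [← Real.mul_rpow zero_le_two he.le, ← Real.rpow_one_add' (by positivity) (by linarith)]
      congr 1; ring
    rw [Real.div_rpow (by positivity) hs.le, show 2 - p = -(p - 2) by ring, Real.rpow_neg hs.le]
    calc _ = A * ((2 * e) * (2 * e) ^ (p - 2)) * (s ^ (p - 2))⁻¹ := by ring
      _ = _ := by rw [← e1]; ring
  rw [h4] at h3
  refine h3.trans (mul_le_mul_of_nonneg_left ?_ (by positivity))
  calc e ^ (p - 1) * s ^ (2 - p)
      ≤ (w ^ (1 / p) * s ^ (1 - 1 / p)) ^ (p - 1) * s ^ (2 - p) := by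
        gcongr
        linarith
    _ = s ^ (1 / p) * w ^ (1 - 1 / p) := by
        rw [Real.mul_rpow (by positivity) (by positivity), ← Real.rpow_mul hw.le,
          ← Real.rpow_mul hs.le, mul_assoc, ← Real.rpow_add hs, mul_comm]
        congr 2
        · field_simp; ring
        · field_simp

theorem weighted_term_le {p : ℝ} {A W Z V w s e : ℝ≥0∞} (hp : 2 ≤ p) (hA0 : A ≠ ∞) (hW0 : W ≠ 0)
    (hWt : W ≠ ∞) (hZ0 : Z ≠ 0) (hZt : Z ≠ ∞) (hV0 : V ≠ 0) (hVt : V ≠ ∞) (hw0 : w ≠ 0)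
    (hwt : w ≠ ∞) (hs0 : s ≠ 0) (hst : s ≠ ∞) (he0 : e ≠ 0) (het : e ≠ ∞)
    (hA : V⁻¹ * W * (V⁻¹ * Z) ^ (p - 1) ≤ A)
    (hVe : V ≤ 2 * e) (hsZ : s ≤ Z) (hews : e ≤ w ^ (1 / p) * s ^ (1 - 1 / p)) :
    V⁻¹ * Z * W ≤ 2 ^ (p - 1) * A * (s ^ (1 / p) * w ^ (1 - 1 / p)) := by
  have hp0 : 0 < 1 / p := by positivity
  have hp1 : 0 ≤ 1 - 1 / p := by
    rw [sub_nonneg, div_le_one (by linarith)]; linarith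
  have hp2 : 0 ≤ p - 1 := by linarith
  have hsr : s ^ (1 - 1 / p) ≠ ∞ := ENNReal.rpow_ne_top_of_nonneg hp1 hst
  have hwr : w ^ (1 - 1 / p) ≠ ∞ := ENNReal.rpow_ne_top_of_nonneg hp1 hwt
  have hsr' : s ^ (1 / p) ≠ ∞ := ENNReal.rpow_ne_top_of_nonneg hp0.le hst
  have hwr' : w ^ (1 / p) ≠ ∞ := ENNReal.rpow_ne_top_of_nonneg hp0.le hwt
  have h2r : (2 : ℝ≥0∞) ^ (p - 1) ≠ ∞ := ENNReal.rpow_ne_top_of_nonneg hp2 ENNReal.ofNat_ne_top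
  have h1 := ENNReal.toReal_mono hA0 hA
  have h2 := ENNReal.toReal_mono (by finiteness) hVe
  have h3 := ENNReal.toReal_mono hZt hsZ
  have h4 := ENNReal.toReal_mono (ENNReal.mul_ne_top hwr' hsr) hews
  have hVi : V⁻¹ ≠ ∞ := ENNReal.inv_ne_top.2 hV0
  rw [← ENNReal.toReal_le_toReal (by finiteness) (by finiteness)]
  simp only [ENNReal.toReal_mul, ← ENNReal.toReal_rpow, ENNReal.toReal_inv,
    ENNReal.toReal_ofNat] at h1 h2 h3 h4 ⊢
  have := weighted_term_le_real hp (ENNReal.toReal_pos hW0 hWt) (ENNReal.toReal_pos hZ0 hZt)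
    (ENNReal.toReal_pos hV0 hVt) (ENNReal.toReal_pos hw0 hwt) (ENNReal.toReal_pos hs0 hst)
    (ENNReal.toReal_pos he0 het) (by simpa only [div_eq_inv_mul] using h1) h2 h3 h4
  refine le_trans (le_of_eq ?_) this
  rw [div_eq_inv_mul, mul_assoc]

theorem div_rpow_mul_self {p : ℝ} (hp : 0 ≤ p) (u : ℝ≥0∞) {s : ℝ≥0∞} (h0 : s ≠ 0) (ht : s ≠ ∞) :
    (u / s) ^ p * s = u ^ p * s ^ (1 - p) := by
  rw [ENNReal.div_rpow_of_nonneg _ _ hp, div_eq_mul_inv, ← ENNReal.rpow_neg, mul_assoc]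
  congr 1
  nth_rw 2 [← ENNReal.rpow_one s]
  rw [← ENNReal.rpow_add _ _ h0 ht]
  congr 1
  ring

variable {ι : Type*}

/-- The dyadic Carleson embedding with respect to a weight. -/
theorem sum_weighted_avg_rpow_le {D : ι → Set ℝ} (hD : IsNested D) {S : Finset ι} {E : ι → Set ℝ}
    (hE : IsSparseFamily D S E) {σ u : ℝ → ℝ≥0∞} (hσ : AEMeasurable σ volume)
    (hσ0 : ∀ᵐ x, 0 < σ x ∧ σ x < ∞) (hu : AEMeasurable u volume)
    (h0 : ∀ i ∈ S, ∫⁻ x in D i, σ x ≠ 0) (ht : ∀ i ∈ S, ∫⁻ x in D i, σ x ≠ ∞)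
    (hut : ∀ i ∈ S, ∫⁻ x in D i, u x ≠ ∞) {p q : ℝ} (hpq : p.HolderConjugate q) :
    ∑ i ∈ S, ((∫⁻ x in D i, u x) / ∫⁻ x in D i, σ x) ^ p * ∫⁻ x in E i, σ x ≤
      ENNReal.ofReal q ^ p * ∫⁻ x, u x ^ p * σ x ^ (1 - p) := by
  -- The quotient of the integrals of `u` and `σ` is the average of `u / σ` against `σ dx`, so the
  -- maximal bound for that measure applies, with a constant independent of the weight.
  set μ := (volume : Measure ℝ).withDensity σ with hμ
  have hac : μ ≪ volume := withDensity_absolutelyContinuous _ _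
  have hh : AEMeasurable (fun x => u x / σ x) volume := hu.div hσ
  have hμD : ∀ i, μ (D i) = ∫⁻ x in D i, σ x := fun i => withDensity_apply _ (hD.measurable i)
  have hb : ∀ i ∈ S, (((∫⁻ x in D i, u x) / ∫⁻ x in D i, σ x).toNNReal : ℝ≥0∞) =
      (∫⁻ x in D i, u x) / ∫⁻ x in D i, σ x := fun i hi =>
    ENNReal.coe_toNNReal (ENNReal.div_ne_top (hut i hi) (h0 i hi))
  have hcancel : ∀ᵐ x, σ x * (u x / σ x) = u x := by
    filter_upwards [hσ0] with x hx
    exact ENNReal.mul_div_cancel hx.1.ne' hx.2.ne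
  have h1 := sum_rpow_le hD μ S (fun i hi => by rw [hμD]; exact ht i hi)
    (fun i => ((∫⁻ x in D i, u x) / ∫⁻ x in D i, σ x).toNNReal) (hh.mono_ac hac)
    (fun i hi => by
      rw [hb i hi, hμD, ENNReal.div_mul_cancel (h0 i hi) (ht i hi), hμ,
        setLIntegral_withDensity_eq_lintegral_mul₀ hσ hh (hD.measurable i)]
      refine lintegral_mono_ae ((ae_restrict_of_ae hcancel).mono fun x hx => ?_)
      rw [Pi.mul_apply, hx])
    (fun i hi => ⟨hE.measurable i hi, hE.subset i hi⟩) hE.disjoint hpq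
  calc _ = ∑ i ∈ S, (((∫⁻ x in D i, u x) / ∫⁻ x in D i, σ x).toNNReal : ℝ≥0∞) ^ p * μ (E i) := by
        refine Finset.sum_congr rfl fun i hi => ?_
        rw [hb i hi, hμ, withDensity_apply _ (hE.measurable i hi)]
    _ ≤ _ := h1
    _ = _ := by
        congr 1
        rw [hμ, lintegral_withDensity_eq_lintegral_mul₀ hσ (hh.pow_const p)]
        refine lintegral_congr_ae ?_
        filter_upwards [hσ0] with x hx
        rw [Pi.mul_apply, mul_comm, div_rpow_mul_self hpq.pos.le _ hx.1.ne' hx.2.ne]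

/-- Hölder applied to `1 = ω^(1/p) σ^(1/q)`. -/
theorem volume_le_weights {p q : ℝ} (hpq : p.HolderConjugate q) {ω σ : ℝ → ℝ≥0∞}
    (hω : AEMeasurable ω volume) (hω0 : ∀ᵐ x, 0 < ω x ∧ ω x < ∞) (hσ : AEMeasurable σ volume)
    (hσω : ∀ᵐ x, σ x = ω x ^ (-(1 / (p - 1)))) (P : Set ℝ) :
    volume P ≤ (∫⁻ x in P, ω x) ^ (1 / p) * (∫⁻ x in P, σ x) ^ (1 / q) := by
  have hp := hpq.pos
  have hq := hpq.symm.pos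
  have hp1 := hpq.sub_one_pos
  have h := ENNReal.lintegral_mul_le_Lp_mul_Lq (volume.restrict P) hpq
    (f := fun x => ω x ^ (1 / p)) (g := fun x => σ x ^ (1 / q))
    (hω.restrict.pow_const _) (hσ.restrict.pow_const _)
  simp only [← ENNReal.rpow_mul, one_div_mul_cancel hp.ne', one_div_mul_cancel hq.ne',
    ENNReal.rpow_one] at h
  refine le_trans (le_of_eq ?_) h
  rw [← setLIntegral_one]
  refine lintegral_congr_ae ?_
  filter_upwards [ae_restrict_of_ae hω0, ae_restrict_of_ae hσω] with x hx hx'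
  rw [Pi.mul_apply, hx', ← ENNReal.rpow_mul, ← ENNReal.rpow_add _ _ hx.1.ne' hx.2.ne]
  have : 1 / p + -(1 / (p - 1)) * (1 / q) = 0 := by
    rw [holderConjugate_one_sub_inv hpq]
    have := hp1.ne'
    field_simp
    ring
  rw [this, ENNReal.rpow_zero]

/-- After the termwise bound, Hölder for sums separates `u` from `v`. The Carleson embedding, with
respect to `σ` at exponent `p` and to `ω` at exponent `q`, bounds the two factors with constants `q`
and `p`. -/
theorem sum_avg_mul_avg_weighted_le {D : ι → Set ℝ} (hD : IsNested D)
    (h0 : ∀ i, volume (D i) ≠ 0) (ht : ∀ i, volume (D i) ≠ ∞) {S : Finset ι} {E : ι → Set ℝ}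
    (hE : IsSparseFamily D S E) {p q : ℝ} (hpq : p.HolderConjugate q) (hp2 : 2 ≤ p)
    {ω σ : ℝ → ℝ≥0∞} (hω : AEMeasurable ω volume) (hω0 : ∀ᵐ x, 0 < ω x ∧ ω x < ∞)
    (hσ : AEMeasurable σ volume) (hσ0 : ∀ᵐ x, 0 < σ x ∧ σ x < ∞)
    (hσω : ∀ᵐ x, σ x = ω x ^ (-(1 / (p - 1)))) {A : ℝ≥0∞} (hA : A ≠ ∞)
    (hAD : ∀ i ∈ S, avg (D i) ω * avg (D i) σ ^ (p - 1) ≤ A) {u v : ℝ → ℝ≥0∞}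
    (hu : AEMeasurable u volume) (hv : AEMeasurable v volume)
    (hut : ∀ i ∈ S, ∫⁻ x in D i, u x ≠ ∞) (hvt : ∀ i ∈ S, ∫⁻ x in D i, v x ≠ ∞) :
    ∑ i ∈ S, avg (D i) u * avg (D i) v * volume (D i) ≤
      2 ^ (p - 1) * (ENNReal.ofReal p * ENNReal.ofReal q) * A *
        ((∫⁻ x, u x ^ p * ω x) ^ (1 / p) * (∫⁻ x, v x ^ q * σ x) ^ (1 / q)) := by
  have hp := hpq.pos
  have hq := hpq.symm.pos
  have hp1 := hpq.sub_one_pos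
  set a : ι → ℝ≥0∞ := fun i => (∫⁻ x in D i, u x) / ∫⁻ x in D i, σ x with ha
  set b : ι → ℝ≥0∞ := fun i => (∫⁻ x in D i, v x) / ∫⁻ x in D i, ω x with hb
  set s : ι → ℝ≥0∞ := fun i => ∫⁻ x in E i, σ x with hs
  set w : ι → ℝ≥0∞ := fun i => ∫⁻ x in E i, ω x with hw
  have he0 : ∀ i ∈ S, volume (E i) ≠ 0 := by
    intro i hi hzero
    have := hE.volume_le i hi
    rw [hzero, mul_zero, nonpos_iff_eq_zero] at this
    exact h0 i this
  have het : ∀ i ∈ S, volume (E i) ≠ ∞ := fun i hi =>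
    measure_ne_top_of_subset (hE.subset i hi) (ht i)
  have hews : ∀ i, volume (E i) ≤ w i ^ (1 / p) * s i ^ (1 / q) := fun i =>
    volume_le_weights hpq hω hω0 hσ hσω (E i)
  have hw0 : ∀ i ∈ S, w i ≠ 0 := by
    intro i hi hzero
    have := hews i
    rw [hzero, ENNReal.zero_rpow_of_pos (by positivity), zero_mul, nonpos_iff_eq_zero] at this
    exact he0 i hi this
  have hs0 : ∀ i ∈ S, s i ≠ 0 := by
    intro i hi hzero
    have := hews i
    rw [hzero, ENNReal.zero_rpow_of_pos (by positivity), mul_zero, nonpos_iff_eq_zero] at this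
    exact he0 i hi this
  have hsZ : ∀ i ∈ S, s i ≤ ∫⁻ x in D i, σ x := fun i hi => lintegral_mono_set (hE.subset i hi)
  have hwW : ∀ i ∈ S, w i ≤ ∫⁻ x in D i, ω x := fun i hi => lintegral_mono_set (hE.subset i hi)
  have hZ0 : ∀ i ∈ S, ∫⁻ x in D i, σ x ≠ 0 := fun i hi h => hs0 i hi (le_zero_iff.1 (h ▸ hsZ i hi))
  have hW0 : ∀ i ∈ S, ∫⁻ x in D i, ω x ≠ 0 := fun i hi h => hw0 i hi (le_zero_iff.1 (h ▸ hwW i hi))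
  have hinv0 : ∀ i, (volume (D i))⁻¹ ≠ 0 := fun i => ENNReal.inv_ne_zero.2 (ht i)
  -- Infinite mass of one weight would make the `A_p` product infinite, because the average of the
  -- other is nonzero.
  have hWt : ∀ i ∈ S, ∫⁻ x in D i, ω x ≠ ∞ := by
    intro i hi htop
    have h1 := hAD i hi
    have h2 : avg (D i) σ ^ (p - 1) ≠ 0 := by
      rw [Ne, ENNReal.rpow_eq_zero_iff_of_pos hp1]
      exact mul_ne_zero (hinv0 i) (hZ0 i hi)
    rw [avg, htop, ENNReal.mul_top (hinv0 i), ENNReal.top_mul h2, top_le_iff] at h1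
    exact hA h1
  have hZt : ∀ i ∈ S, ∫⁻ x in D i, σ x ≠ ∞ := by
    intro i hi htop
    have h1 := hAD i hi
    have h2 : avg (D i) ω ≠ 0 := mul_ne_zero (hinv0 i) (hW0 i hi)
    rw [avg.eq_1 (D i) σ, htop, ENNReal.mul_top (hinv0 i), ENNReal.top_rpow_of_pos hp1,
      ENNReal.mul_top h2, top_le_iff] at h1
    exact hA h1
  have hterm : ∀ i ∈ S, avg (D i) u * avg (D i) v * volume (D i) ≤
      2 ^ (p - 1) * A * ((a i * s i ^ (1 / p)) * (b i * w i ^ (1 / q))) := by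
    intro i hi
    have h1 := weighted_term_le hp2 hA (hW0 i hi) (hWt i hi) (hZ0 i hi) (hZt i hi) (h0 i) (ht i)
      (hw0 i hi) (ne_top_of_le_ne_top (hWt i hi) (hwW i hi)) (hs0 i hi)
      (ne_top_of_le_ne_top (hZt i hi) (hsZ i hi)) (he0 i hi) (het i hi) (hAD i hi)
      (hE.volume_le i hi) (hsZ i hi) (by
        rw [← holderConjugate_one_sub_inv hpq]; exact hews i)
    rw [← holderConjugate_one_sub_inv hpq] at h1
    have e1 : ∫⁻ x in D i, u x = a i * ∫⁻ x in D i, σ x :=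
      (ENNReal.div_mul_cancel (hZ0 i hi) (hZt i hi)).symm
    have e2 : ∫⁻ x in D i, v x = b i * ∫⁻ x in D i, ω x :=
      (ENNReal.div_mul_cancel (hW0 i hi) (hWt i hi)).symm
    calc avg (D i) u * avg (D i) v * volume (D i)
        = avg (D i) u * (avg (D i) v * volume (D i)) := mul_assoc _ _ _
      _ = a i * b i * ((volume (D i))⁻¹ * (∫⁻ x in D i, σ x) * ∫⁻ x in D i, ω x) := by
          rw [avg_mul_volume (h0 i) (ht i), avg, e1, e2]; ring
      _ ≤ a i * b i * (2 ^ (p - 1) * A * (s i ^ (1 / p) * w i ^ (1 / q))) :=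
          mul_le_mul_right h1 _
      _ = _ := by ring
  have hsumA : (∑ i ∈ S, (a i * s i ^ (1 / p)) ^ p) ^ (1 / p) ≤
      ENNReal.ofReal q * (∫⁻ x, u x ^ p * ω x) ^ (1 / p) := by
    have h1 := sum_weighted_avg_rpow_le hD hE hσ hσ0 hu hZ0 hZt hut hpq
    have e1 : ∫⁻ x, u x ^ p * σ x ^ (1 - p) = ∫⁻ x, u x ^ p * ω x := by
      refine lintegral_congr_ae ?_
      filter_upwards [hσω] with x hx
      rw [hx, ← ENNReal.rpow_mul]
      have : -(1 / (p - 1)) * (1 - p) = 1 := by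
        have := hp1.ne'
        field_simp
        ring
      rw [this, ENNReal.rpow_one]
    rw [e1] at h1
    calc (∑ i ∈ S, (a i * s i ^ (1 / p)) ^ p) ^ (1 / p) = (∑ i ∈ S, a i ^ p * s i) ^ (1 / p) := by
          congr 1
          refine Finset.sum_congr rfl fun i _ => ?_
          rw [ENNReal.mul_rpow_of_nonneg _ _ hp.le, ← ENNReal.rpow_mul, one_div_mul_cancel hp.ne',
            ENNReal.rpow_one]
      _ ≤ (ENNReal.ofReal q ^ p * ∫⁻ x, u x ^ p * ω x) ^ (1 / p) :=
          ENNReal.rpow_le_rpow h1 (by positivity)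
      _ = _ := by
          rw [ENNReal.mul_rpow_of_nonneg _ _ (by positivity), ← ENNReal.rpow_mul,
            mul_one_div_cancel hp.ne', ENNReal.rpow_one]
  have hsumB : (∑ i ∈ S, (b i * w i ^ (1 / q)) ^ q) ^ (1 / q) ≤
      ENNReal.ofReal p * (∫⁻ x, v x ^ q * σ x) ^ (1 / q) := by
    have h1 := sum_weighted_avg_rpow_le hD hE hω hω0 hv hW0 hWt hvt hpq.symm
    have e1 : ∫⁻ x, v x ^ q * ω x ^ (1 - q) = ∫⁻ x, v x ^ q * σ x := by
      refine lintegral_congr_ae ?_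
      filter_upwards [hσω] with x hx
      have : 1 - q = -(1 / (p - 1)) := by
        rw [hpq.conjugate_eq]
        have := hp1.ne'
        field_simp
        ring
      rw [hx, this]
    rw [e1] at h1
    calc (∑ i ∈ S, (b i * w i ^ (1 / q)) ^ q) ^ (1 / q) = (∑ i ∈ S, b i ^ q * w i) ^ (1 / q) := by
          congr 1
          refine Finset.sum_congr rfl fun i _ => ?_
          rw [ENNReal.mul_rpow_of_nonneg _ _ hq.le, ← ENNReal.rpow_mul, one_div_mul_cancel hq.ne',
            ENNReal.rpow_one]
      _ ≤ (ENNReal.ofReal p ^ q * ∫⁻ x, v x ^ q * σ x) ^ (1 / q) :=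
          ENNReal.rpow_le_rpow h1 (by positivity)
      _ = _ := by
          rw [ENNReal.mul_rpow_of_nonneg _ _ (by positivity), ← ENNReal.rpow_mul,
            mul_one_div_cancel hq.ne', ENNReal.rpow_one]
  calc ∑ i ∈ S, avg (D i) u * avg (D i) v * volume (D i)
      ≤ ∑ i ∈ S, 2 ^ (p - 1) * A * ((a i * s i ^ (1 / p)) * (b i * w i ^ (1 / q))) :=
        Finset.sum_le_sum hterm
    _ = 2 ^ (p - 1) * A * ∑ i ∈ S, (a i * s i ^ (1 / p)) * (b i * w i ^ (1 / q)) := by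
        rw [Finset.mul_sum]
    _ ≤ 2 ^ (p - 1) * A * ((ENNReal.ofReal q * (∫⁻ x, u x ^ p * ω x) ^ (1 / p)) *
          (ENNReal.ofReal p * (∫⁻ x, v x ^ q * σ x) ^ (1 / q))) := by
        refine mul_le_mul_right ((ENNReal.inner_le_Lp_mul_Lq S _ _ hpq).trans ?_) _
        exact mul_le_mul' hsumA hsumB
    _ = _ := by ring

end Weighted

/-! ### Weighted bounds for the operator, all `p > 1` -/

section WeightedOperator

theorem avg_cell_mul_le_apConst (p : ℝ) (ω : ℝ → ℝ≥0∞) (α : ℝ) (i : ℤ × ℤ) :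
    avg (cell α i) ω * avg (cell α i) (fun x => ω x ^ (-(1 / (p - 1)))) ^ (p - 1) ≤
      apConst p ω := by
  rw [avg_congr_set (cell_ae_eq_dyadic α i), avg_congr_set (cell_ae_eq_dyadic α i), dyadic]
  exact le_iSup_of_le _ (le_iSup_of_le _ (le_iSup_of_le (left_lt_right α i) le_rfl))

/-- The constant of the weighted estimate for a sparse form. -/
noncomputable def weightConst (p : ℝ) : ℝ≥0∞ :=
  (2 ^ (p - 1) + 2 ^ (p / (p - 1) - 1)) * (ENNReal.ofReal p * ENNReal.ofReal (p / (p - 1)))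

theorem weightConst_ne_top {p : ℝ} (hp : 1 < p) : weightConst p ≠ ∞ := by
  have hp1 : 0 < p - 1 := by linarith
  have h1 : (2 : ℝ≥0∞) ^ (p - 1) ≠ ∞ := ENNReal.rpow_ne_top_of_nonneg hp1.le ENNReal.ofNat_ne_top
  have h2 : (2 : ℝ≥0∞) ^ (p / (p - 1) - 1) ≠ ∞ := by
    refine ENNReal.rpow_ne_top_of_nonneg ?_ ENNReal.ofNat_ne_top
    rw [sub_nonneg, one_le_div hp1]
    linarith
  unfold weightConst
  finiteness

/-- For `p ≤ 2` the roles of `(u, ω, p)` and `(v, σ, q)` are exchanged. Since `q - 1 = 1 / (p - 1)`,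
the `A_q` product of `σ` is the `1 / (p - 1)` power of the `A_p` product of `ω`; this is the source
of the maximum in the exponent. -/
theorem sum_avg_mul_avg_le_apConst {p q : ℝ} (hpq : p.HolderConjugate q) {ω : ℝ → ℝ≥0∞}
    (hω : IsApWeight p ω) {α : ℝ} (hD : IsNested (cell α)) {S : Finset (ℤ × ℤ)}
    {E : ℤ × ℤ → Set ℝ} (hE : IsSparseFamily (cell α) S E) {u v : ℝ → ℝ≥0∞}
    (hu : AEMeasurable u volume) (hv : AEMeasurable v volume)
    (hut : ∀ i ∈ S, ∫⁻ x in cell α i, u x ≠ ∞) (hvt : ∀ i ∈ S, ∫⁻ x in cell α i, v x ≠ ∞) :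
    ∑ i ∈ S, avg (cell α i) u * avg (cell α i) v * volume (cell α i) ≤
      weightConst p * apConst p ω ^ max 1 (1 / (p - 1)) *
        ((∫⁻ x, u x ^ p * ω x) ^ (1 / p) *
          (∫⁻ x, v x ^ q * ω x ^ (-(1 / (p - 1)))) ^ (1 / q)) := by
  obtain ⟨hωm, hω0, hAt⟩ := hω
  have hp := hpq.pos
  have hq := hpq.symm.pos
  have hp1 := hpq.sub_one_pos
  have hq1 := hpq.symm.sub_one_pos
  have hqe : q = p / (p - 1) := hpq.conjugate_eq
  have hq1e : 1 / (p - 1) = q - 1 := by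
    rw [hqe]
    have := hp1.ne'
    field_simp
    ring
  have hp1e : 1 / (q - 1) = p - 1 := by rw [← hq1e, one_div_one_div]
  set σ : ℝ → ℝ≥0∞ := fun x => ω x ^ (-(1 / (p - 1))) with hσ
  have hσm : AEMeasurable σ volume := hωm.pow_const _
  have hσ0 : ∀ᵐ x, 0 < σ x ∧ σ x < ∞ := by
    filter_upwards [hω0] with x hx
    exact ⟨ENNReal.rpow_pos hx.1 hx.2.ne, (ENNReal.rpow_ne_top_of_ne_zero hx.1.ne' hx.2.ne).lt_top⟩
  rcases le_total 2 p with h2 | h2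
  · have hmax : max 1 (1 / (p - 1)) = 1 := by
      rw [max_eq_left]
      rw [div_le_one hp1]; linarith
    rw [hmax, ENNReal.rpow_one]
    refine (sum_avg_mul_avg_weighted_le hD (volume_cell_ne_zero α) (volume_cell_ne_top α) hE hpq h2
      hωm hω0 hσm hσ0 (Filter.Eventually.of_forall fun x => rfl) hAt.ne
      (fun i _ => avg_cell_mul_le_apConst p ω α i) hu hv hut hvt).trans ?_
    rw [weightConst, ← hqe]
    gcongr
    exact le_self_add
  · have hmax : max 1 (1 / (p - 1)) = 1 / (p - 1) := by
      rw [max_eq_right]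
      rw [le_div_iff₀ hp1]; linarith
    have hq2 : 2 ≤ q := by
      have : 1 ≤ 1 / (p - 1) := by rw [le_div_iff₀ hp1]; linarith
      linarith
    have hωσ : ∀ᵐ x, ω x = σ x ^ (-(1 / (q - 1))) := by
      refine Filter.Eventually.of_forall fun x => ?_
      rw [hσ]
      simp only
      rw [← ENNReal.rpow_mul, hp1e]
      have : -(1 / (p - 1)) * -(p - 1) = 1 := by
        have := hp1.ne'
        field_simp
      rw [this, ENNReal.rpow_one]
    have hAD : ∀ i ∈ S, avg (cell α i) σ * avg (cell α i) ω ^ (q - 1) ≤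
        apConst p ω ^ (1 / (p - 1)) := by
      intro i _
      refine le_trans (le_of_eq ?_) (ENNReal.rpow_le_rpow (avg_cell_mul_le_apConst p ω α i)
        (one_div_pos.2 hp1).le)
      rw [ENNReal.mul_rpow_of_nonneg _ _ (one_div_pos.2 hp1).le, ← ENNReal.rpow_mul,
        mul_one_div_cancel hp1.ne', ENNReal.rpow_one, ← hq1e, mul_comm]
    have h := sum_avg_mul_avg_weighted_le hD (volume_cell_ne_zero α) (volume_cell_ne_top α) hE
      hpq.symm hq2 hσm hσ0 hωm hω0 hωσ
      (ENNReal.rpow_ne_top_of_nonneg (one_div_pos.2 hp1).le hAt.ne) hAD hv hu hvt hut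
    rw [hmax]
    calc ∑ i ∈ S, avg (cell α i) u * avg (cell α i) v * volume (cell α i)
        = ∑ i ∈ S, avg (cell α i) v * avg (cell α i) u * volume (cell α i) :=
          Finset.sum_congr rfl fun i _ => by rw [mul_comm (avg _ u)]
      _ ≤ _ := h
      _ ≤ _ := by
        rw [weightConst, ← hqe, mul_comm (ENNReal.ofReal q), mul_comm ((∫⁻ x, v x ^ q * _) ^ _)]
        gcongr
        exact le_add_self

variable {𝕜 : Type*} [RCLike 𝕜]

theorem eLpNorm_withDensity_eq {p : ℝ} (hp : 0 < p) {ω : ℝ → ℝ≥0∞} (hω : AEMeasurable ω volume)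
    (f : L2 𝕜) : eLpNorm f (ENNReal.ofReal p) (volume.withDensity ω) =
      (∫⁻ x, ‖f x‖ₑ ^ p * ω x) ^ (1 / p) := by
  rw [eLpNorm_eq_lintegral_rpow_enorm_toReal (by simpa using hp) ENNReal.ofReal_ne_top,
    ENNReal.toReal_ofReal hp.le, lintegral_withDensity_eq_lintegral_mul₀ hω
      ((aemeasurable_enorm_L2 f).pow_const p)]
  congr 1
  exact lintegral_congr fun x => mul_comm _ _

theorem lintegral_cell_L2_ne_top (f : L2 𝕜) (α : ℝ) (i : ℤ × ℤ) :
    ∫⁻ x in cell α i, ‖f x‖ₑ ≠ ∞ := by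
  have : IsFiniteMeasure (volume.restrict (cell α i)) :=
    ⟨by rw [Measure.restrict_apply_univ]; exact (volume_cell_ne_top α i).lt_top⟩
  have h : Integrable f (volume.restrict (cell α i)) :=
    ((Lp.memLp f).restrict _).integrable one_le_two
  exact h.2.ne

/-- Duality without density arguments: `T f` is paired with an aligned function of size at most `|T
f|^(p-1) ω`, truncated to `P n`, and the resulting inequality is absorbed. The truncation is then
removed by monotone convergence. -/
theorem weighted_bound_of_sparseBound {T : L2 𝕜 →L[𝕜] L2 𝕜} {C : ℝ≥0}
    (hT : ∀ f g : L2 𝕜, SparseBound C ‖inner 𝕜 (T f) g‖ₑ (fun x => ‖f x‖ₑ) fun x => ‖g x‖ₑ)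
    {p : ℝ} (hp : 1 < p) {ω : ℝ → ℝ≥0∞} (hω : IsApWeight p ω) :
    weightedOpNorm T p ω ≤ C * weightConst p * apConst p ω ^ max 1 (1 / (p - 1)) := by
  set q := p / (p - 1) with hq
  have hpq : p.HolderConjugate q := Real.HolderConjugate.conjExponent hp
  have hp0 := hpq.pos
  have hq0 := hpq.symm.pos
  have hp1 := hpq.sub_one_pos
  refine sInf_le fun f _ => ?_
  rw [eLpNorm_withDensity_eq hp0 hω.1, eLpNorm_withDensity_eq hp0 hω.1]
  set Λ := C * weightConst p * apConst p ω ^ max 1 (1 / (p - 1)) with hΛ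
  set Φ := (∫⁻ x, ‖f x‖ₑ ^ p * ω x) ^ (1 / p) with hΦ
  set h := T f with hh
  set ρ : ℝ → ℝ := fun x => (hω.1.mk ω x).toReal with hρ
  have hρm : Measurable ρ := hω.1.measurable_mk.ennreal_toReal
  have hρω : ∀ᵐ x, ENNReal.ofReal (ρ x) = ω x := by
    filter_upwards [hω.1.ae_eq_mk, hω.2.1] with x hx hx'
    rw [hρ]
    simp only
    rw [← hx, ENNReal.ofReal_toReal hx'.2.ne]
  have hhm : Measurable fun x => ‖h x‖ := (Lp.stronglyMeasurable h).norm.measurable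
  -- On `P n` both `h` and the weight are bounded and the measure is finite, so the test function is
  -- in `L²` and the truncated integral is finite.
  set P : ℕ → Set ℝ := fun n => {x | ‖h x‖ ≤ n} ∩ {x | ρ x ≤ n} ∩ Icc (-n : ℝ) n with hP
  have hPm : ∀ n, MeasurableSet (P n) := fun n =>
    ((measurableSet_le hhm measurable_const).inter
      (measurableSet_le hρm measurable_const)).inter measurableSet_Icc
  have hPv : ∀ n, volume (P n) ≠ ∞ := fun n =>
    measure_ne_top_of_subset inter_subset_right (by rw [Real.volume_Icc]; finiteness)
  have hPmono : Monotone P := by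
    intro m n hmn x hx
    have hmn' : (m : ℝ) ≤ n := by exact_mod_cast hmn
    exact ⟨⟨le_trans hx.1.1 hmn', le_trans hx.1.2 hmn'⟩,
      ⟨by linarith [hx.2.1], by linarith [hx.2.2]⟩⟩
  have hPU : ⋃ n, P n = univ := by
    refine eq_univ_of_forall fun x => mem_iUnion.2 ?_
    obtain ⟨n₁, h₁⟩ := exists_nat_ge ‖h x‖
    obtain ⟨n₂, h₂⟩ := exists_nat_ge (ρ x)
    obtain ⟨n₃, h₃⟩ := exists_nat_ge |x|
    have e1 : (n₁ : ℝ) ≤ (n₁ + n₂ + n₃ : ℕ) := by exact_mod_cast (by omega)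
    have e2 : (n₂ : ℝ) ≤ (n₁ + n₂ + n₃ : ℕ) := by exact_mod_cast (by omega)
    have e3 : (n₃ : ℝ) ≤ (n₁ + n₂ + n₃ : ℕ) := by exact_mod_cast (by omega)
    exact ⟨n₁ + n₂ + n₃, ⟨⟨h₁.trans e1, h₂.trans e2⟩, abs_le.1 (h₃.trans e3)⟩⟩
  have hbound : ∀ n, ∫⁻ x in P n, ‖h x‖ₑ ^ p * ω x ≤ (Λ * Φ) ^ p := by
    intro n
    set φ : ℝ → ℝ := (P n).indicator fun x => ‖h x‖ ^ (p - 1) * ρ x with hφ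
    have hφ0 : ∀ x, 0 ≤ φ x := fun x => indicator_nonneg (fun x _ =>
      mul_nonneg (Real.rpow_nonneg (norm_nonneg _) _) ENNReal.toReal_nonneg) x
    have hφm : Measurable φ := ((hhm.pow_const _).mul hρm).indicator (hPm n)
    have hφL : MemLp φ 2 volume := by
      refine (memLp_indicator_const (μ := volume) 2 (hPm n) ((n : ℝ) ^ (p - 1) * n)
        (Or.inr (hPv n))).of_le hφm.aestronglyMeasurable (Filter.Eventually.of_forall fun x => ?_)
      rw [Real.norm_of_nonneg (hφ0 x)]
      refine le_trans ?_ (le_abs_self _)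
      refine indicator_le_indicator' fun hx => ?_
      exact mul_le_mul (Real.rpow_le_rpow (norm_nonneg _) hx.1.1 hp1.le) hx.1.2
        ENNReal.toReal_nonneg (Real.rpow_nonneg (Nat.cast_nonneg n) _)
    obtain ⟨g, hg, hin⟩ := exists_dual h hφ0 hφL
    have hφe : ∀ᵐ x, ENNReal.ofReal (φ x) =
        (P n).indicator (fun x => ‖h x‖ₑ ^ (p - 1) * ω x) x := by
      filter_upwards [hρω] with x hx
      by_cases hxP : x ∈ P n
      · rw [hφ, indicator_of_mem hxP, indicator_of_mem hxP, ENNReal.ofReal_mul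
          (Real.rpow_nonneg (norm_nonneg _) _), hx,
          ← ENNReal.ofReal_rpow_of_nonneg (norm_nonneg _) hp1.le, ofReal_norm]
      · rw [hφ, indicator_of_notMem hxP, indicator_of_notMem hxP, ENNReal.ofReal_zero]
    have hX : ‖inner 𝕜 h g‖ₑ = ∫⁻ x in P n, ‖h x‖ₑ ^ p * ω x := by
      rw [hin, ← lintegral_indicator (hPm n)]
      refine lintegral_congr_ae ?_
      filter_upwards [hφe] with x hx
      rw [hx]
      by_cases hxP : x ∈ P n
      · rw [indicator_of_mem hxP, indicator_of_mem hxP, ← mul_assoc]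
        congr 1
        nth_rw 1 [← ENNReal.rpow_one ‖h x‖ₑ]
        rw [← ENNReal.rpow_add_of_nonneg _ _ zero_le_one hp1.le, add_sub_cancel]
      · rw [indicator_of_notMem hxP, indicator_of_notMem hxP, mul_zero]
    set X := ∫⁻ x in P n, ‖h x‖ₑ ^ p * ω x with hXdef
    have hXt : X ≠ ∞ := hX ▸ enorm_ne_top
    -- The choice of test function makes its dual norm reproduce the same integral: `(|h|^(p-1) ω)^q
    -- σ = |h|^p ω`.
    have hgX : ∫⁻ x, ‖g x‖ₑ ^ q * ω x ^ (-(1 / (p - 1))) ≤ X := by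
      rw [hXdef, ← lintegral_indicator (hPm n)]
      refine lintegral_mono_ae ?_
      filter_upwards [hg, hφe, hω.2.1] with x hx hx' hx0
      rw [hx'] at hx
      by_cases hxP : x ∈ P n
      · rw [indicator_of_mem hxP] at hx ⊢
        refine (mul_le_mul_left (ENNReal.rpow_le_rpow hx hq0.le) _).trans (le_of_eq ?_)
        rw [ENNReal.mul_rpow_of_nonneg _ _ hq0.le, ← ENNReal.rpow_mul, hpq.sub_one_mul_conj,
          mul_assoc, ← ENNReal.rpow_add _ _ hx0.1.ne' hx0.2.ne]
        have : q + -(1 / (p - 1)) = 1 := by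
          rw [hq]
          have := hp1.ne'
          field_simp
          ring
        rw [this, ENNReal.rpow_one]
      · rw [indicator_of_notMem hxP] at hx ⊢
        rw [nonpos_iff_eq_zero.1 hx, ENNReal.zero_rpow_of_pos hq0, zero_mul]
    obtain ⟨b, S, E, hE, hS⟩ := hT f g
    have hform := sum_avg_mul_avg_le_apConst hpq hω (isNested_shift b) hE
      (aemeasurable_enorm_L2 f) (aemeasurable_enorm_L2 g)
      (fun i _ => lintegral_cell_L2_ne_top f _ i) fun i _ => lintegral_cell_L2_ne_top g _ i
    refine le_rpow_of_le_mul_rpow hpq hXt ?_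
    calc X = ‖inner 𝕜 h g‖ₑ := hX.symm
      _ ≤ _ := hS.trans (mul_le_mul_right hform _)
      _ ≤ C * (weightConst p * apConst p ω ^ max 1 (1 / (p - 1)) * (Φ * X ^ (1 / q))) := by
          gcongr
      _ = Λ * Φ * X ^ (1 / q) := by rw [hΛ]; ring
  have htotal : ∫⁻ x, ‖h x‖ₑ ^ p * ω x ≤ (Λ * Φ) ^ p := by
    rw [← setLIntegral_univ, ← hPU, setLIntegral_iUnion_of_directed _ hPmono.directed_le]
    exact iSup_le hbound
  calc (∫⁻ x, ‖h x‖ₑ ^ p * ω x) ^ (1 / p) ≤ ((Λ * Φ) ^ p) ^ (1 / p) :=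
        ENNReal.rpow_le_rpow htotal (by positivity)
    _ = Λ * Φ := by rw [← ENNReal.rpow_mul, mul_one_div_cancel hp0.ne', ENNReal.rpow_one]

end WeightedOperator

/-! ### Passage to collections of closed intervals -/

section Collections

/-- `IsSparse` indexes the sets `E` by the intervals themselves, so the index is recovered from the
interval by injectivity of the grid. -/
theorem isSparse_image {α : ℝ} {S : Finset (ℤ × ℤ)} {E : ℤ × ℤ → Set ℝ}
    (hE : IsSparseFamily (cell α) S E) : IsSparse (1 / 2) (dyadic α '' S) := by
  have hinj := Function.leftInverse_invFun (dyadic_injective α)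
  refine ⟨fun Q => E (Function.invFun (dyadic α) Q), ?_, ?_⟩
  · rintro _ ⟨i, hi, rfl⟩
    simp only [hinj i]
    refine ⟨hE.measurable i hi, (hE.subset i hi).trans (cell_subset_dyadic α i), ?_⟩
    have h1 := hE.volume_le i hi
    rw [measure_congr (cell_ae_eq_dyadic α i)] at h1
    have h2 : ENNReal.ofReal (1 / 2) = 2⁻¹ := by
      rw [one_div, ENNReal.ofReal_inv_of_pos two_pos]; norm_num
    rw [h2, ← ENNReal.div_eq_inv_mul]
    exact ENNReal.div_le_of_le_mul' h1
  · rintro _ ⟨i, hi, rfl⟩ _ ⟨j, hj, rfl⟩ hij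
    simp only [Function.onFun, hinj i, hinj j]
    exact hE.disjoint hi hj fun h => hij (h ▸ rfl)

theorem tsum_dyadic_image (α : ℝ) (S : Finset (ℤ × ℤ)) (Φ : Set ℝ → ℝ≥0∞) :
    ∑' Q : (dyadic α '' (S : Set (ℤ × ℤ)) : Set (Set ℝ)), Φ Q = ∑ i ∈ S, Φ (dyadic α i) := by
  rw [tsum_image Φ (dyadic_injective α).injOn]
  exact Finset.tsum_subtype S fun i => Φ (dyadic α i)

theorem grid_shift_subset (b : Bool) : grid (shift b) ⊆ grids := by
  cases b
  · rw [shift, if_neg (by simp)]; exact subset_union_left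
  · rw [shift, if_pos rfl]; exact subset_union_right

end Collections

/-- A sparse form is symmetric in its two functions, so a bound for `⟨T g, f⟩` is one for `⟨T* f,
g⟩`. -/
theorem sparseBound_adjoint {𝕜 : Type*} [RCLike 𝕜] {T : L2 𝕜 →L[𝕜] L2 𝕜} {C : ℝ≥0∞}
    (hT : ∀ f g : L2 𝕜, SparseBound C ‖inner 𝕜 (T f) g‖ₑ (fun x => ‖f x‖ₑ) fun x => ‖g x‖ₑ)
    (f g : L2 𝕜) : SparseBound C ‖inner 𝕜 (ContinuousLinearMap.adjoint T f) g‖ₑ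
      (fun x => ‖f x‖ₑ) fun x => ‖g x‖ₑ := by
  have e : ‖inner 𝕜 (ContinuousLinearMap.adjoint T f) g‖ₑ = ‖inner 𝕜 (T g) f‖ₑ := by
    rw [ContinuousLinearMap.adjoint_inner_left, ← ofReal_norm, ← ofReal_norm, norm_inner_symm]
  rw [e]
  exact (hT g f).symm

end SparseDom

/-! ### Assembly of the main theorem -/

theorem mainTheorem5 {𝕜 : Type*} [RCLike 𝕜] :
    ∃ η : ℝ, 0 < η ∧ η < 1 ∧
      ∀ M : ℕ, 3 ≤ M → ∀ C₀ C₁ C₂ : ℝ≥0, ∃ (C : ℝ≥0) (K : ℝ → ℝ≥0),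
      ∀ (T : SparseDom.L2 𝕜 →L[𝕜] SparseDom.L2 𝕜) (a : ℤ × ℤ → SparseDom.L2 𝕜 → 𝕜),
        SparseDom.FormBound T a C₀ →
        SparseDom.EnergyCondition a M C₁ →
        SparseDom.SizeCondition a M C₂ →
        -- localization of the model form
        (∀ (F : Finset (ℤ × ℤ)) (ε : ℤ × ℤ → 𝕜), (∀ i, ‖ε i‖ ≤ 1) →
          ∀ (i₀ : ℤ × ℤ) (f g : SparseDom.L2 𝕜),
            ‖SparseDom.modelForm a ε (SparseDom.below F i₀) f g‖ₑ ≤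
              C * (SparseDom.sizeTilde M F i₀ f * SparseDom.sizeTilde M F i₀ g *
                volume (SparseDom.interval i₀))) ∧
        -- sparse domination of the model form
        (∀ (F : Finset (ℤ × ℤ)) (ε : ℤ × ℤ → 𝕜), (∀ i, ‖ε i‖ ≤ 1) →
          ∀ f g : SparseDom.L2 𝕜, ∃ S : Set (Set ℝ),
            S ⊆ SparseDom.grid 0 ∧ SparseDom.IsSparse η S ∧
            ‖SparseDom.modelForm a ε F f g‖ₑ ≤ C * SparseDom.sparseFormChi M S f g) ∧
        -- sparse domination of the operator
        (∀ f g : SparseDom.L2 𝕜, ∃ S : Set (Set ℝ),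
            S ⊆ SparseDom.grids ∧ SparseDom.IsSparse η S ∧
            ‖inner 𝕜 (T f) g‖ₑ ≤ C * SparseDom.sparseForm S f g) ∧
        -- weak type of the operator and of its adjoint
        SparseDom.WeakTypeOne T C ∧
        SparseDom.WeakTypeOne (ContinuousLinearMap.adjoint T) C ∧
        -- weighted bounds
        (∀ p : ℝ, 1 < p → ∀ ω : ℝ → ℝ≥0∞, SparseDom.IsApWeight p ω →
          SparseDom.weightedOpNorm T p ω +
              SparseDom.weightedOpNorm (ContinuousLinearMap.adjoint T) p ω ≤
            K p * SparseDom.apConst p ω ^ max 1 (1 / (p - 1))) := by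
  open SparseDom in
  refine ⟨1 / 2, by norm_num, by norm_num, fun M hM C₀ C₁ C₂ => ?_⟩
  set A := sparseConst M C₀ C₂
  -- The three summands serve the local estimate, the form with tails, and the weak type bound, the
  -- last also covering the sparse bound of the operator. In `K p` the `2` accounts for `T` and its
  -- adjoint, and `toNNReal` loses nothing when `p > 1`, the only range used.
  refine ⟨C₂ ^ 2 + C₂ ^ 2 * tailThreshold M ^ 2 + 32 * A,
    fun p => (2 * (A * weightConst p)).toNNReal, fun T a hT _ hS => ?_⟩
  set C : ℝ≥0 := C₂ ^ 2 + C₂ ^ 2 * tailThreshold M ^ 2 + 32 * A with hC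
  have hC1 : ((C₂ ^ 2 : ℝ≥0) : ℝ≥0∞) ≤ C :=
    ENNReal.coe_le_coe.2 (by rw [hC, add_assoc]; exact le_self_add)
  have hC2 : ((C₂ ^ 2 * tailThreshold M ^ 2 : ℝ≥0) : ℝ≥0∞) ≤ C :=
    ENNReal.coe_le_coe.2 (by rw [hC, add_right_comm]; exact le_add_self)
  have hC4 : ((32 * A : ℝ≥0) : ℝ≥0∞) ≤ C := ENNReal.coe_le_coe.2 le_add_self
  have hC3 : (A : ℝ≥0∞) ≤ C :=
    le_trans (ENNReal.coe_le_coe.2 (le_mul_of_one_le_left' (by norm_num))) hC4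
  have hB : ∀ f g : L2 𝕜, SparseBound A ‖inner 𝕜 (T f) g‖ₑ (fun x => ‖f x‖ₑ) fun x => ‖g x‖ₑ :=
    sparseBound_inner hM hT hS
  refine ⟨fun F ε hε i₀ f g => ?_, fun F ε hε f g => ?_, fun f g => ?_, ?_, ?_, ?_⟩
  · refine (enorm_modelForm_le hε _ f g).trans ((sum_enorm_mul_le hS F i₀ f g).trans ?_)
    rw [ENNReal.coe_pow] at hC1
    exact mul_le_mul_left hC1 _
  · obtain ⟨S, E, hE, hs⟩ := exists_sparse_tailAvg hM hS F f g
    refine ⟨dyadic 0 '' S, image_subset_range _ _, isSparse_image hE, ?_⟩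
    refine (enorm_modelForm_le hε F f g).trans (hs.trans (mul_le_mul' hC2 (le_of_eq ?_)))
    rw [sparseFormChi, tsum_dyadic_image 0 S fun Q => locAvg M Q f * locAvg M Q g * volume Q]
    refine Finset.sum_congr rfl fun i _ => ?_
    rw [locAvg_eq_tailAvg, locAvg_eq_tailAvg, ← measure_congr (cell_ae_eq_dyadic 0 i)]
    rfl
  · obtain ⟨b, S, E, hE, hs⟩ := hB f g
    refine ⟨dyadic (shift b) '' S, (image_subset_range _ _).trans (grid_shift_subset b),
      isSparse_image hE, hs.trans (mul_le_mul' hC3 (le_of_eq ?_))⟩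
    rw [sparseForm, tsum_dyadic_image (shift b) S
      fun Q => avg Q (fun x => ‖f x‖ₑ) * avg Q (fun x => ‖g x‖ₑ) * volume Q]
    refine Finset.sum_congr rfl fun i _ => ?_
    rw [avg_congr_set (cell_ae_eq_dyadic _ i), avg_congr_set (cell_ae_eq_dyadic _ i),
      measure_congr (cell_ae_eq_dyadic _ i)]
  · intro f hf t ht
    exact (weakTypeOne_of_sparseBound hB f hf t ht).trans (mul_le_mul_left hC4 _)
  · intro f hf t ht
    exact (weakTypeOne_of_sparseBound (sparseBound_adjoint hB) f hf t ht).trans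
      (mul_le_mul_left hC4 _)
  · intro p hp ω hω
    have hK : 2 * (A * weightConst p) ≠ ∞ := by
      have := weightConst_ne_top hp
      finiteness
    rw [ENNReal.coe_toNNReal hK]
    refine (add_le_add (weighted_bound_of_sparseBound hB hp hω)
      (weighted_bound_of_sparseBound (sparseBound_adjoint hB) hp hω)).trans (le_of_eq ?_)
    ring
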